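/- Let $k$ be an algebraically closed field, let $N\ge 1$ and $L\ge 2$ be integers with $\operatorname{char}k\nmid 2NL$, and let $\nu,\lambda\in\{1,-1\}$. For $i,j\in\{1,2\}$ and $m\ge 1$ write $\chi_{ij}^m=x_{ij}\,x_{i+1,j+1}\,x_{ij}\cdots$ ($m$ factors, indices modulo $2$). Let $A_{NL}^{\nu\lambda}$ be the $k$-algebra generated by $x_{11},x_{12},x_{21},x_{22}$ with the relations $$x_{11}^2=x_{22}^2,\quad x_{12}^2=x_{21}^2,\quad x_{ij}x_{lm}=0\ \ (i-j\not\equiv l-m \bmod 2),$$ $$x_{11}^{2N}+\nu x_{12}^{2N}=1,\quad \chi_{11}^L=\chi_{22}^L,\quad \chi_{21}^L=\lambda\chi_{12}^L .$$ It is a Hopf algebra with $\Delta(x_{ij})=x_{i1}\otimes x_{1j}+x_{i2}\otimes x_{2j}$, $\varepsilon(x_{ij})=\delta_{ij}$, $S(x_{ij})=x_{ji}^{4N-1}$. A braiding of a bialgebra $A$ is a convolution-invertible linear map $\sigma:A\otimes A\to k$ such that, for all $x,y,z\in A$, $\sum\sigma(x_{(1)},y_{(1)})x_{(2)}y_{(2)}=\sum\sigma(x_{(2)},y_{(2)})y_{(1)}x_{(1)}$,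 $\sigma(xy,z)=\sum\sigma(x,z_{(1)})\sigma(y,z_{(2)})$ and $\sigma(x,yz)=\sum\sigma(x_{(1)},z)\sigma(x_{(2)},y)$. A coribbon element of the braided bialgebra $(A,\sigma)$ is a convolution-invertible $\theta\in A^*$ such that, for all $x,y\in A$, $\sum\theta(x_{(1)})x_{(2)}=\sum\theta(x_{(2)})x_{(1)}$, $\theta(xy)=\sum\sigma^{-1}(x_{(1)},y_{(1)})\theta(x_{(2)})\theta(y_{(2)})\sigma^{-1}(y_{(3)},x_{(3)})$ and $\theta(1)=1$. If $A$ is a Hopf algebra, a coribbon element of the braided Hopf algebra $(A,\sigma)$ is one that also satisfies $\theta\circ S=\theta$. For $\omega\in k$ let $\theta_\omega$ be the linear functional on $\operatorname{span}\{x_{ij}\}$ with $\theta_\omega(x_{ij})=\delta_{ij}\omega$; its extension to a coribbon element, which is unique if it exists, is denoted by the same symbol. **(1)** Let $\alpha,\beta\in k^\times$ satisfy $(\alpha\beta)^N=\nu$ and $(\alpha\beta^{-1})^L=\lambda$. There is a unique braiding $\sigma_{\alpha\beta}$ of $A_{NL}^{\nu\lambda}$ with $\sigma_{\alpha\beta}(x_{12},x_{12})=\sigma_{\alpha\beta}(x_{21},x_{21})=\alpha$,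 $\sigma_{\alpha\beta}(x_{12},x_{21})=\sigma_{\alpha\beta}(x_{21},x_{12})=\beta$ and value $0$ on all other pairs of generators. For $\omega\in k$, $\theta_\omega$ extends to a coribbon element of the braided bialgebra $(A_{NL}^{\nu\lambda},\sigma_{\alpha\beta})$ if and only if $\omega^{2N}=\alpha^{2N}$, and every coribbon element of this braided bialgebra is of the form $\theta_\omega$. Moreover $\theta_\omega$ is a coribbon element of the braided Hopf algebra $(A_{NL}^{\nu\lambda},\sigma_{\alpha\beta})$ if and only if $\omega=\pm\beta^{-1}$, and this braided Hopf algebra has exactly two coribbon elements. **(2)** Let $L=2$, and let $\gamma,\delta\in k^\times$ satisfy $\gamma^2=\delta^2$ and $\gamma^{2N}=1$. There is a unique braiding $\tau^\lambda_{\gamma\delta}$ of $A_{N2}^{\nu\lambda}$ with $\tau^\lambda_{\gamma\delta}(x_{11},x_{11})=\tau^\lambda_{\gamma\delta}(x_{22},x_{22})=\gamma$, $\tau^\lambda_{\gamma\delta}(x_{11},x_{22})=\delta$, $\tau^\lambda_{\gamma\delta}(x_{22},x_{11})=\lambda\delta$ and value $0$ on all other pairs of generators. For $\omega\in k$, $\theta_\omega$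 extends to a coribbon element of the braided bialgebra $(A_{N2}^{\nu\lambda},\tau^\lambda_{\gamma\delta})$ if and only if $\omega^{2N}=1$, and every coribbon element of this braided bialgebra is of the form $\theta_\omega$. Moreover $\theta_\omega$ is a coribbon element of the braided Hopf algebra $(A_{N2}^{\nu\lambda},\tau^\lambda_{\gamma\delta})$ if and only if $\omega=\pm\gamma^{-1}$, and this braided Hopf algebra has exactly two coribbon elements. -/

import Mathlib

open scoped TensorProduct

noncomputable section

/-! ### Braided bialgebras and coribbon elements

Sums in Sweedler notation are written through the convolution product
`(f * g)(x) = ∑ f(x₍₁₎) g(x₍₂₎)` of Mathlib, which lives on `WithConv (C →ₗ[k] R)`. -/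

section Coribbon

open WithConv

variable {k A : Type*} [Field k] [Ring A]

/-- A linear functional `f : C → k`, regarded as a linear map `C → A` with values in `k · 1`. -/
def asScalar {C : Type*} [AddCommMonoid C] [Module k C] (A : Type*) [Ring A] [Algebra k A]
    (f : C →ₗ[k] k) : C →ₗ[k] A :=
  Algebra.linearMap k A ∘ₗ f

/-- The linear functional `σ : A ⊗ A → k` is a braiding of the bialgebra `A`. -/
structure IsBraiding [Bialgebra k A] (σ : A ⊗[k] A →ₗ[k] k) : Prop where
  /-- `σ` is convolution-invertible. -/
  isUnit : IsUnit (toConv σ)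
  /-- `∑ σ(x₍₁₎, y₍₁₎) x₍₂₎ y₍₂₎ = ∑ σ(x₍₂₎, y₍₂₎) y₍₁₎ x₍₁₎`. -/
  comm : toConv (asScalar A σ) * toConv (LinearMap.mul' k A) =
    toConv (LinearMap.mul' k A ∘ₗ (TensorProduct.comm k A A).toLinearMap) * toConv (asScalar A σ)
  /-- `σ(x y, z) = ∑ σ(x, z₍₁₎) σ(y, z₍₂₎)`. -/
  mul_left : ∀ x y z : A, σ ((x * y) ⊗ₜ z) =
    (toConv (TensorProduct.curry σ x) * toConv (TensorProduct.curry σ y)) z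
  /-- `σ(x, y z) = ∑ σ(x₍₁₎, z) σ(x₍₂₎, y)`. -/
  mul_right : ∀ x y z : A, σ (x ⊗ₜ (y * z)) =
    (toConv ((TensorProduct.curry σ).flip z) * toConv ((TensorProduct.curry σ).flip y)) x

/-- The linear functional `θ` is a coribbon element of the braided bialgebra `(A, σ)`.
`Ring.inverse (toConv σ)` is the convolution inverse of `σ`. -/
structure IsCoribbon [Bialgebra k A] (σ : A ⊗[k] A →ₗ[k] k) (θ : A →ₗ[k] k) : Prop where
  /-- `θ` is convolution-invertible. -/
  isUnit : IsUnit (toConv θ)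
  /-- `∑ θ(x₍₁₎) x₍₂₎ = ∑ θ(x₍₂₎) x₍₁₎`. -/
  central : toConv (asScalar A θ) * toConv (LinearMap.id : A →ₗ[k] A) =
    toConv (LinearMap.id : A →ₗ[k] A) * toConv (asScalar A θ)
  /-- `θ(x y) = ∑ σ⁻¹(x₍₁₎, y₍₁₎) θ(x₍₂₎) θ(y₍₂₎) σ⁻¹(y₍₃₎, x₍₃₎)`. -/
  map_mul : toConv (θ ∘ₗ LinearMap.mul' k A) =
    Ring.inverse (toConv σ) * toConv (LinearMap.mul' k k ∘ₗ TensorProduct.map θ θ) *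
      toConv ((Ring.inverse (toConv σ)).ofConv ∘ₗ (TensorProduct.comm k A A).toLinearMap)
  map_one : θ 1 = 1

/-- The linear functional `θ` is a coribbon element of the braided Hopf algebra `(A, σ)`. -/
structure IsHopfCoribbon [HopfAlgebra k A] (σ : A ⊗[k] A →ₗ[k] k) (θ : A →ₗ[k] k) : Prop
    extends IsCoribbon σ θ where
  comp_antipode : θ ∘ₗ HopfAlgebra.antipode k = θ

end Coribbon

/-! ### Suzuki's Hopf algebras

The indices `1, 2` are written `0, 1 : Fin 2`, with arithmetic modulo `2`. -/

/-- The alternating product `x_{ij} x_{i+1,j+1} x_{ij} ⋯` with `m` factors. -/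
def chi {R : Type*} [Monoid R] (x : Fin 2 → Fin 2 → R) : Fin 2 → Fin 2 → ℕ → R
  | _, _, 0 => 1
  | i, j, m + 1 => x i j * chi x (i + 1) (j + 1) m

/-- The defining relations of Suzuki's algebra, on the tensor algebra of the `2 × 2` comatrix
coalgebra, that is, the free algebra on four generators `X_{ij}`. -/
inductive SuzukiRel (k : Type*) [Field k] (N L : ℕ) (ν lam : ℤˣ) :
    FreeAlgebra k (Fin 2 × Fin 2) → FreeAlgebra k (Fin 2 × Fin 2) → Prop
  | sq_diag : SuzukiRel k N L ν lam
      (FreeAlgebra.ι k (0, 0) ^ 2) (FreeAlgebra.ι k (1, 1) ^ 2)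
  | sq_off : SuzukiRel k N L ν lam
      (FreeAlgebra.ι k (0, 1) ^ 2) (FreeAlgebra.ι k (1, 0) ^ 2)
  | mul_zero (i j l m : Fin 2) (h : i - j ≠ l - m) : SuzukiRel k N L ν lam
      (FreeAlgebra.ι k (i, j) * FreeAlgebra.ι k (l, m)) 0
  | pow : SuzukiRel k N L ν lam
      (FreeAlgebra.ι k (0, 0) ^ (2 * N) +
        ((ν : ℤ) : FreeAlgebra k (Fin 2 × Fin 2)) * FreeAlgebra.ι k (0, 1) ^ (2 * N)) 1
  | chi_diag : SuzukiRel k N L ν lam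
      (chi (fun i j => FreeAlgebra.ι k (i, j)) 0 0 L)
      (chi (fun i j => FreeAlgebra.ι k (i, j)) 1 1 L)
  | chi_off : SuzukiRel k N L ν lam
      (chi (fun i j => FreeAlgebra.ι k (i, j)) 1 0 L)
      (((lam : ℤ) : FreeAlgebra k (Fin 2 × Fin 2)) *
        chi (fun i j => FreeAlgebra.ι k (i, j)) 0 1 L)

/-- Suzuki's algebra `A_{NL}^{νλ}`. -/
def SuzukiAlg (k : Type*) [Field k] (N L : ℕ) (ν lam : ℤˣ) : Type _ :=
  RingQuot (SuzukiRel k N L ν lam)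

namespace SuzukiAlg

variable {k : Type*} [Field k] {N L : ℕ} {ν lam : ℤˣ}

instance : Ring (SuzukiAlg k N L ν lam) :=
  inferInstanceAs (Ring (RingQuot (SuzukiRel k N L ν lam)))

instance : Algebra k (SuzukiAlg k N L ν lam) :=
  inferInstanceAs (Algebra k (RingQuot (SuzukiRel k N L ν lam)))

/-- The projection from the free algebra. -/
def proj : FreeAlgebra k (Fin 2 × Fin 2) →ₐ[k] SuzukiAlg k N L ν lam :=
  RingQuot.mkAlgHom k (SuzukiRel k N L ν lam)

/-- The generators `x_{ij}`. -/
def x (i j : Fin 2) : SuzukiAlg k N L ν lam :=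
  proj (FreeAlgebra.ι k (i, j))

theorem map_chi {R S : Type*} [Monoid R] [Monoid S] (f : R →* S) (y : Fin 2 → Fin 2 → R)
    (i j : Fin 2) (m : ℕ) : f (chi y i j m) = chi (fun a b => f (y a b)) i j m := by
  induction m generalizing i j with
  | zero => simp [chi]
  | succ m ih => simp [chi, ih]

/-- A family of elements of a ring that satisfies the defining relations. -/
structure Sat {R : Type*} [Ring R] (N L : ℕ) (ν lam : ℤˣ) (y : Fin 2 → Fin 2 → R) : Prop where
  sq : ∀ i j, y i j ^ 2 = y (i + 1) (j + 1) ^ 2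
  mul_zero : ∀ i j l m, i - j ≠ l - m → y i j * y l m = 0
  pow : y 0 0 ^ (2 * N) + ((ν : ℤ) : R) * y 0 1 ^ (2 * N) = 1
  chi_diag : chi y 0 0 L = chi y 1 1 L
  chi_off : chi y 1 0 L = ((lam : ℤ) : R) * chi y 0 1 L

theorem sat_x : Sat N L ν lam (x : Fin 2 → Fin 2 → SuzukiAlg k N L ν lam) := by
  have h : ∀ {p q}, SuzukiRel k N L ν lam p q →
      (proj p : SuzukiAlg k N L ν lam) = proj q := fun h => RingQuot.mkAlgHom_rel k h
  have hd := h SuzukiRel.sq_diag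
  have ho := h SuzukiRel.sq_off
  have hp := h SuzukiRel.pow
  have hc := h SuzukiRel.chi_diag
  have hc' := h SuzukiRel.chi_off
  have key : ∀ i j m, (proj (chi (fun i j => FreeAlgebra.ι k (i, j)) i j m) :
      SuzukiAlg k N L ν lam) = chi x i j m := fun i j m =>
    map_chi (proj : FreeAlgebra k (Fin 2 × Fin 2) →ₐ[k] SuzukiAlg k N L ν lam).toRingHom.toMonoidHom
      _ i j m
  simp only [map_pow, map_add, map_mul, map_one, map_intCast, key] at hd ho hp hc hc'
  refine ⟨?_, ?_, hp, hc, hc'⟩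
  · intro i j
    fin_cases i <;> fin_cases j
    exacts [hd, ho, ho.symm, hd.symm]
  · intro i j l m hne
    simpa only [x, map_mul, map_zero] using h (SuzukiRel.mul_zero i j l m hne)

/-- The algebra map given by a family that satisfies the relations. -/
def lift {R : Type*} [Ring R] [Algebra k R] (y : Fin 2 → Fin 2 → R) (hy : Sat N L ν lam y) :
    SuzukiAlg k N L ν lam →ₐ[k] R :=
  RingQuot.liftAlgHom k ⟨FreeAlgebra.lift k (fun p : Fin 2 × Fin 2 => y p.1 p.2), by
    have key : ∀ i j m, FreeAlgebra.lift k (fun p : Fin 2 × Fin 2 => y p.1 p.2)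
        (chi (fun i j => FreeAlgebra.ι k (i, j)) i j m) = chi y i j m := fun i j m => by
      have := map_chi (FreeAlgebra.lift k
        (fun p : Fin 2 × Fin 2 => y p.1 p.2)).toRingHom.toMonoidHom
        (fun i j => FreeAlgebra.ι k (i, j)) i j m
      simpa using this
    intro p q h
    cases h with
    | sq_diag => simpa using hy.sq 0 0
    | sq_off => simpa using hy.sq 0 1
    | mul_zero i j l m h => simpa using hy.mul_zero i j l m h
    | pow => simpa using hy.pow
    | chi_diag => rw [key, key, hy.chi_diag]
    | chi_off => rw [map_mul, key, key, map_intCast, hy.chi_off]⟩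

@[simp] theorem lift_x {R : Type*} [Ring R] [Algebra k R] (y : Fin 2 → Fin 2 → R)
    (hy : Sat N L ν lam y) (i j : Fin 2) : lift (k := k) y hy (x i j) = y i j := by
  unfold lift x proj
  erw [RingQuot.liftAlgHom_mkAlgHom_apply]
  simp

theorem algHom_ext {R : Type*} [Semiring R] [Algebra k R] {f g : SuzukiAlg k N L ν lam →ₐ[k] R}
    (h : ∀ i j, f (x i j) = g (x i j)) : f = g := by
  apply RingQuot.ringQuot_ext'
  apply FreeAlgebra.hom_ext
  funext p
  exact h p.1 p.2

theorem induction {P : SuzukiAlg k N L ν lam → Prop} (hs : ∀ r : k, P (algebraMap k _ r))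
    (hx : ∀ i j, P (x i j)) (hmul : ∀ a b, P a → P b → P (a * b))
    (hadd : ∀ a b, P a → P b → P (a + b)) (a : SuzukiAlg k N L ν lam) : P a := by
  obtain ⟨a, rfl⟩ : ∃ b, proj b = a := RingQuot.mkAlgHom_surjective k _ a
  induction a using FreeAlgebra.induction with
  | grade0 r => simpa using hs r
  | grade1 p => exact hx p.1 p.2
  | mul a b ha hb => simpa using hmul _ _ ha hb
  | add a b ha hb => simpa using hadd _ _ ha hb


section comul

variable {R : Type*} [Ring R] [Algebra k R] {y : Fin 2 → Fin 2 → R}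

theorem Sat.mul_pow_zero (h : Sat N L ν lam y) {i j l m : Fin 2} (hne : i - j ≠ l - m) (n : ℕ) :
    y i j ^ (n + 1) * y l m = 0 := by
  rw [pow_succ, mul_assoc, h.mul_zero i j l m hne, MulZeroClass.mul_zero]

theorem Sat.mul_chi_zero (h : Sat N L ν lam y) {i j l m : Fin 2} (hne : i - j ≠ l - m) (n : ℕ) :
    y i j * chi y l m (n + 1) = 0 := by
  rw [chi, ← mul_assoc, h.mul_zero i j l m hne, MulZeroClass.zero_mul]

/-- The comatrix family `∑ₘ y_{im} ⊗ y_{mj}`. -/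
def comat (k : Type*) [Field k] {R : Type*} [Ring R] [Algebra k R] (y : Fin 2 → Fin 2 → R)
    (i j : Fin 2) : R ⊗[k] R :=
  ∑ m, y i m ⊗ₜ[k] y m j

theorem Sat.comat_pow (h : Sat N L ν lam y) (i j : Fin 2) (n : ℕ) :
    comat k y i j ^ (n + 1) = ∑ m, (y i m ^ (n + 1)) ⊗ₜ[k] (y m j ^ (n + 1)) := by
  induction n with
  | zero => simp [comat]
  | succ n ih =>
    rw [pow_succ, ih, comat]
    simp only [Fin.sum_univ_two, add_mul, mul_add, Algebra.TensorProduct.tmul_mul_tmul]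
    rw [h.mul_pow_zero (l := i) (m := 1) (i := i) (j := 0) (by clear ih; revert i; decide),
      h.mul_pow_zero (l := i) (m := 0) (i := i) (j := 1) (by clear ih; revert i; decide)]
    simp [pow_succ]

theorem Sat.comat_chi (h : Sat N L ν lam y) (i j : Fin 2) (n : ℕ) :
    chi (comat k y) i j (n + 1) = ∑ m, chi y i m (n + 1) ⊗ₜ[k] chi y m j (n + 1) := by
  induction n generalizing i j with
  | zero => simp [comat, chi]
  | succ n ih =>
    rw [chi, ih, comat]
    simp only [Fin.sum_univ_two, add_mul, mul_add, Algebra.TensorProduct.tmul_mul_tmul]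
    rw [h.mul_chi_zero (l := i + 1) (m := 0) (i := i) (j := 0) (by clear ih; revert i; decide),
      h.mul_chi_zero (l := i + 1) (m := 1) (i := i) (j := 1) (by clear ih; revert i; decide)]
    simp [chi, add_comm]

theorem Sat.sat_comat [NeZero N] [NeZero L] (h : Sat N L ν lam y) :
    Sat N L ν lam (comat k y) := by
  obtain ⟨N, rfl⟩ := Nat.exists_eq_succ_of_ne_zero (NeZero.ne N)
  obtain ⟨L, rfl⟩ := Nat.exists_eq_succ_of_ne_zero (NeZero.ne L)
  have hν : ((ν : ℤ) : R ⊗[k] R) * ((ν : ℤ) : R ⊗[k] R) = 1 := by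
    rcases Int.units_eq_one_or ν with rfl | rfl <;> simp
  have hl : ((lam : ℤ) : R) * ((lam : ℤ) : R) = 1 := by
    rcases Int.units_eq_one_or lam with rfl | rfl <;> simp
  refine ⟨fun i j => ?_, fun i j l m hne => ?_, ?_, ?_, ?_⟩
  · rw [h.comat_pow i j 1, h.comat_pow (i + 1) (j + 1) 1]
    simp only [Fin.sum_univ_two]
    rw [h.sq i 0, h.sq i 1, h.sq 0 j, h.sq 1 j, add_comm]
    rfl
  · simp only [SuzukiAlg.comat, Fin.sum_univ_two, add_mul, mul_add,
      Algebra.TensorProduct.tmul_mul_tmul]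
    have e : ∀ a b : Fin 2, (y i a * y l b) ⊗ₜ[k] (y a j * y b m) = 0 := by
      intro a b
      by_cases hab : i - a = l - b
      · rw [h.mul_zero a j b m (by revert i j l m a b; decide), TensorProduct.tmul_zero]
      · rw [h.mul_zero i a l b hab, TensorProduct.zero_tmul]
    simp only [e, add_zero]
  · have e : 2 * (N + 1) = (2 * N + 1) + 1 := by ring
    have hp := h.pow
    have h11 : y 1 1 ^ (2 * N + 1 + 1) = y 0 0 ^ (2 * N + 1 + 1) := by
      rw [← e, pow_mul, pow_mul, h.sq 0 0]; rfl
    have h10 : y 1 0 ^ (2 * N + 1 + 1) = y 0 1 ^ (2 * N + 1 + 1) := by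
      rw [← e, pow_mul, pow_mul, h.sq 0 1]; rfl
    rw [Nat.succ_eq_add_one, e] at *
    rw [h.comat_pow, h.comat_pow]
    simp only [Fin.sum_univ_two, h11, h10]
    generalize y 0 0 ^ (2 * N + 1 + 1) = p at *
    generalize y 0 1 ^ (2 * N + 1 + 1) = q at *
    rcases Int.units_eq_one_or ν with rfl | rfl
    · simp only [Units.val_one, Int.cast_one, one_mul] at hp ⊢
      rw [Algebra.TensorProduct.one_def, ← hp]
      simp only [TensorProduct.add_tmul, TensorProduct.tmul_add]
      abel
    · simp only [Units.val_neg, Units.val_one, Int.cast_neg, Int.cast_one, neg_mul, one_mul] at hp ⊢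
      rw [Algebra.TensorProduct.one_def, ← hp]
      simp only [TensorProduct.add_tmul, TensorProduct.tmul_add, TensorProduct.neg_tmul,
        TensorProduct.tmul_neg]
      abel
  · rw [Nat.succ_eq_add_one, h.comat_chi, h.comat_chi]
    have h1 := h.chi_diag
    have h2 := h.chi_off
    simp only [Fin.sum_univ_two, h1, h2]
    rcases Int.units_eq_one_or lam with rfl | rfl
    · simp [add_comm]
    · simp [add_comm, TensorProduct.neg_tmul, TensorProduct.tmul_neg]
  · rw [Nat.succ_eq_add_one, h.comat_chi, h.comat_chi]
    have h1 := h.chi_diag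
    have h2 := h.chi_off
    simp only [Fin.sum_univ_two, h1, h2]
    rcases Int.units_eq_one_or lam with rfl | rfl
    · simp [add_comm]
    · simp [add_comm, TensorProduct.neg_tmul, TensorProduct.tmul_neg]

end comul

theorem sat_counit [NeZero N] [NeZero L] :
    Sat N L ν lam (fun i j : Fin 2 => if i = j then (1 : k) else 0) := by
  have hc : ∀ i j m, chi (fun i j : Fin 2 => if i = j then (1 : k) else 0) i j (m + 1) =
      if i = j then 1 else 0 := by
    intro i j m
    induction m generalizing i j with
    | zero => simp [chi]
    | succ m ih => rw [chi, ih]; split_ifs <;> simp_all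
  obtain ⟨L, rfl⟩ := Nat.exists_eq_succ_of_ne_zero (NeZero.ne L)
  refine ⟨fun i j => by simp, fun i j l m hne => ?_, ?_, ?_, ?_⟩
  · split_ifs <;> simp_all
  · simp [NeZero.ne N]
  · rw [Nat.succ_eq_add_one, hc, hc]; simp
  · rw [Nat.succ_eq_add_one, hc, hc]; simp

section antipode

open MulOpposite

variable {R : Type*} [Ring R] {y : Fin 2 → Fin 2 → R}

theorem Sat.pow_facts [NeZero N] (h : Sat N L ν lam y) :
    (∀ n, (y 0 0 ^ (2 * N)) ^ (n + 1) = y 0 0 ^ (2 * N)) ∧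
    (y 0 1 ^ (2 * N)) ^ 2 = ((ν : ℤ) : R) * y 0 1 ^ (2 * N) ∧
    (∀ n, (y 0 1 ^ (2 * N)) ^ (2 * n + 1) = y 0 1 ^ (2 * N)) := by
  have hp := h.pow
  obtain ⟨n, hn⟩ : ∃ n, 2 * N = n + 1 := ⟨2 * N - 1, by have := NeZero.pos N; omega⟩
  have hpq : y 0 0 ^ (2 * N) * y 0 1 ^ (2 * N) = 0 := by
    rw [hn, pow_succ' (y 0 1), ← mul_assoc, h.mul_pow_zero (by decide), MulZeroClass.zero_mul]
  have hqp : y 0 1 ^ (2 * N) * y 0 0 ^ (2 * N) = 0 := by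
    rw [hn, pow_succ' (y 0 0), ← mul_assoc, h.mul_pow_zero (by decide), MulZeroClass.zero_mul]
  generalize y 0 0 ^ (2 * N) = p at *
  generalize y 0 1 ^ (2 * N) = q at *
  have hpp : p * p = p := by
    have : p * (p + ((ν : ℤ) : R) * q) = p := by rw [hp, mul_one]
    rwa [mul_add, ← mul_assoc, ← (Int.cast_commute (ν : ℤ) p).eq, mul_assoc, hpq,
      MulZeroClass.mul_zero, add_zero] at this
  have hqq : q * q = ((ν : ℤ) : R) * q := by
    have : (p + ((ν : ℤ) : R) * q) * q = q := by rw [hp, one_mul]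
    rw [add_mul, hpq, zero_add] at this
    rcases Int.units_eq_one_or ν with rfl | rfl
    · simpa using this
    · simp only [Units.val_neg, Units.val_one, Int.cast_neg, Int.cast_one, neg_mul, one_mul]
        at this ⊢
      exact (neg_eq_iff_eq_neg.mp this)
  have hqqq : q ^ 2 * q = q := by
    rw [pow_two, hqq, mul_assoc, hqq, ← mul_assoc]
    rcases Int.units_eq_one_or ν with rfl | rfl <;> simp
  refine ⟨fun n => ?_, by rw [pow_two, hqq], fun n => ?_⟩
  · induction n with
    | zero => simp
    | succ n ih => rw [pow_succ, ih, hpp]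
  · induction n with
    | zero => simp
    | succ n ih =>
      rw [show 2 * (n + 1) + 1 = 2 + (2 * n + 1) by ring, pow_add, ih, hqqq]

theorem Sat.pow_even (h : Sat N L ν lam y) (i j : Fin 2) (n : ℕ) :
    y i j ^ (2 * n) = y (i + 1) (j + 1) ^ (2 * n) := by
  rw [pow_mul, pow_mul, h.sq]

theorem Sat.sum_pow_four [NeZero N] (h : Sat N L ν lam y) :
    y 0 0 ^ (4 * N) + y 0 1 ^ (4 * N) = 1 := by
  obtain ⟨h1, h2, -⟩ := h.pow_facts
  rw [show 4 * N = 2 * N * 2 by ring, pow_mul _ (2 * N), pow_mul _ (2 * N), h1 1, h2]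
  exact h.pow

theorem ofNat_succ (m : ℕ) : Fin.ofNat 2 (m + 1) = Fin.ofNat 2 m + 1 := by
  apply Fin.ext
  simp [Fin.val_add]

theorem chi_succ_right (y : Fin 2 → Fin 2 → R) (i j : Fin 2) (m : ℕ) :
    chi y i j (m + 1) = chi y i j m * y (i + Fin.ofNat 2 m) (j + Fin.ofNat 2 m) := by
  induction m generalizing i j with
  | zero => simp [chi]
  | succ m ih =>
    rw [chi, ih, ← mul_assoc]
    change chi y i j (m + 1) * _ = _
    rw [ofNat_succ, add_comm (Fin.ofNat 2 m), add_assoc, add_assoc]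

theorem Sat.commute_chi (h : Sat N L ν lam y) (i j : Fin 2) (n m : ℕ) :
    Commute (y i j ^ (2 * n)) (chi y i j m) := by
  induction m generalizing i j with
  | zero => simp [chi]
  | succ m ih =>
    rw [chi]
    refine Commute.mul_right ((Commute.refl _).pow_left _) ?_
    rw [h.pow_even]
    exact ih _ _

theorem Sat.chi_op (h : Sat N L ν lam y) (n : ℕ) (i j : Fin 2) (m : ℕ) :
    (chi (fun i j => op (y j i ^ (2 * n + 1))) i j m).unop =
      (y j i ^ (2 * n)) ^ m * chi y (j + Fin.ofNat 2 m + 1) (i + Fin.ofNat 2 m + 1) m := by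
  induction m generalizing i j with
  | zero => simp [chi]
  | succ m ih =>
    have e : ∀ a : Fin 2, a + 1 + Fin.ofNat 2 m + 1 = a + Fin.ofNat 2 m := fun a => by
      generalize Fin.ofNat 2 m = b; clear ih; revert a b; decide
    have e1 : ∀ a : Fin 2, a + Fin.ofNat 2 (m + 1) + 1 = a + Fin.ofNat 2 m := fun a => by
      rw [ofNat_succ]; generalize Fin.ofNat 2 m = b; clear ih; revert a b; decide
    have e2 : ∀ a : Fin 2, a + Fin.ofNat 2 m + Fin.ofNat 2 m = a := fun a => by
      generalize Fin.ofNat 2 m = b; clear ih; revert a b; decide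
    rw [chi, unop_mul, ih, unop_op, e, e, e1, e1, chi_succ_right, e2, e2, ← h.pow_even]
    have hc : Commute (y j i ^ (2 * n)) (chi y (j + Fin.ofNat 2 m) (i + Fin.ofNat 2 m) m) := by
      have := h.commute_chi (j + Fin.ofNat 2 m) (i + Fin.ofNat 2 m) n m
      have e3 : y (j + Fin.ofNat 2 m) (i + Fin.ofNat 2 m) ^ (2 * n) = y j i ^ (2 * n) := by
        generalize Fin.ofNat 2 m = b
        fin_cases b
        · simp
        · exact (h.pow_even j i n).symm
      rwa [e3] at this
    rw [pow_succ (y j i), pow_succ (y j i ^ (2 * n)), mul_assoc, mul_assoc,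
      ← mul_assoc (chi y _ _ _), ← hc.eq, mul_assoc]

theorem Sat.sat_op [NeZero N] (h : Sat N L ν lam y) :
    Sat N L ν lam (fun i j => op (y j i ^ (4 * N - 1))) := by
  have hN := NeZero.pos N
  obtain ⟨n, hn⟩ : ∃ n, N = n + 1 := ⟨N - 1, by omega⟩
  have hl : ((lam : ℤ) : R) * ((lam : ℤ) : R) = 1 := by
    rcases Int.units_eq_one_or lam with rfl | rfl <;> simp
  have e : 4 * N - 1 = 2 * (2 * n + 1) + 1 := by omega
  obtain ⟨h1, -, h3⟩ := h.pow_facts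
  have hs : ∀ i j, (y i j ^ (4 * N - 1)) ^ 2 = y i j ^ (2 * (4 * N - 1)) := fun i j => by
    rw [← pow_mul, mul_comm]
  have hz : ∀ a b : Fin 2, chi y a a L = chi y b b L := by
    intro a b
    fin_cases a <;> fin_cases b
    exacts [rfl, h.chi_diag, h.chi_diag.symm, rfl]
  have hw : ∀ a : Fin 2, chi y (a + 1) a L = ((lam : ℤ) : R) * chi y a (a + 1) L := by
    intro a
    fin_cases a
    · exact h.chi_off
    · change chi y 0 1 L = _ * chi y 1 0 L
      rw [h.chi_off, ← mul_assoc, hl, one_mul]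
  refine ⟨fun i j => ?_, fun i j l m hne => ?_, ?_, ?_, ?_⟩
  · simp only [← op_pow]
    rw [hs, hs, h.pow_even]
  · simp only [← op_mul]
    rw [e, pow_succ' (y j i), ← mul_assoc, h.mul_pow_zero (by revert i j l m; decide),
      MulZeroClass.zero_mul, op_zero]
  · simp only [← op_pow]
    have h10 : y 1 0 ^ (2 * N) = y 0 1 ^ (2 * N) := h.pow_even 1 0 N
    rw [← pow_mul, ← pow_mul, mul_comm (4 * N - 1), pow_mul _ (2 * N), pow_mul _ (2 * N), h10, e, h1, h3]
    rw [← op_intCast, ← op_mul, ← op_add, ← (Int.cast_commute _ _).eq, h.pow, op_one]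
  · apply unop_injective
    rw [e, h.chi_op, h.chi_op, h.pow_even, hz _ (1 + Fin.ofNat 2 L + 1)]
    rfl
  · apply unop_injective
    have hL : ∀ a : Fin 2, 1 + Fin.ofNat 2 L + 1 = Fin.ofNat 2 L ∧
        0 + Fin.ofNat 2 L + 1 = Fin.ofNat 2 L + 1 := fun a => by
      generalize Fin.ofNat 2 L = b; revert b; decide
    rw [e, unop_mul, h.chi_op, h.chi_op, h.pow_even, (hL 0).1, (hL 0).2, hw, unop_intCast,
      ← (Int.cast_commute _ _).eq, ← mul_assoc, ← mul_assoc, (Int.cast_commute _ _).eq]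
    rfl

end antipode

set_option linter.unusedSectionVars false

variable [NeZero N] [NeZero L]

/-- The bialgebra structure with `Δ(x_{ij}) = ∑ₘ x_{im} ⊗ x_{mj}` and `ε(x_{ij}) = δ_{ij}`. -/
instance : Bialgebra k (SuzukiAlg k N L ν lam) :=
  Bialgebra.ofAlgHom (lift (comat k x) sat_x.sat_comat)
    (lift (fun i j => if i = j then (1 : k) else 0) sat_counit)
    (by
      apply algHom_ext
      intro i j
      simp [comat, TensorProduct.add_tmul, TensorProduct.tmul_add]
      abel)
    (by
      apply algHom_ext
      intro i j
      fin_cases i <;> fin_cases j <;> simp [comat])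
    (by
      apply algHom_ext
      intro i j
      fin_cases i <;> fin_cases j <;> simp [comat])

theorem comul_x (i j : Fin 2) :
    Coalgebra.comul (R := k) (x i j : SuzukiAlg k N L ν lam) = ∑ m, x i m ⊗ₜ[k] x m j :=
  lift_x _ _ i j

theorem counit_x (i j : Fin 2) :
    Coalgebra.counit (R := k) (x i j : SuzukiAlg k N L ν lam) = if i = j then 1 else 0 :=
  lift_x _ _ i j

/-- The antipode as an algebra map to the opposite algebra. -/
def antipodeAux : SuzukiAlg k N L ν lam →ₐ[k] (SuzukiAlg k N L ν lam)ᵐᵒᵖ :=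
  lift (fun i j => MulOpposite.op (x j i ^ (4 * N - 1))) sat_x.sat_op

/-- The linear map `S` with `S(x_{ij}) = x_{ji}^{4N-1}` that reverses products. -/
def antipodeLin : SuzukiAlg k N L ν lam →ₗ[k] SuzukiAlg k N L ν lam :=
  (MulOpposite.opLinearEquiv k).symm.toLinearMap ∘ₗ antipodeAux.toLinearMap

theorem antipodeLin_x (i j : Fin 2) :
    antipodeLin (x i j : SuzukiAlg k N L ν lam) = x j i ^ (4 * N - 1) := by
  simp [antipodeLin, antipodeAux]

theorem antipodeLin_mul (a b : SuzukiAlg k N L ν lam) :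
    antipodeLin (a * b) = antipodeLin b * antipodeLin a := by
  simp [antipodeLin]

theorem antipodeLin_algebraMap (r : k) :
    antipodeLin (algebraMap k (SuzukiAlg k N L ν lam) r) = algebraMap k _ r := by
  simp [antipodeLin]

theorem antipode_left (a : SuzukiAlg k N L ν lam) :
    LinearMap.mul' k _ (antipodeLin.rTensor _ (Coalgebra.comul (R := k) a)) =
      algebraMap k _ (Coalgebra.counit (R := k) a) := by
  induction a using induction with
  | hs r => simp [Algebra.TensorProduct.algebraMap_apply, antipodeLin_algebraMap]
  | hx i j =>
    have h := sat_x (k := k) (N := N) (L := L) (ν := ν) (lam := lam)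
    have h4 := h.sum_pow_four
    have hN := NeZero.pos N
    obtain ⟨n, hn⟩ : ∃ n, 4 * N = n + 1 + 1 := ⟨4 * N - 2, by omega⟩
    have e11 : x 1 1 ^ (4 * N) = (x 0 0 : SuzukiAlg k N L ν lam) ^ (4 * N) := by
      rw [show 4 * N = 2 * (2 * N) by ring]; exact h.pow_even 1 1 _
    have e10 : x 1 0 ^ (4 * N) = (x 0 1 : SuzukiAlg k N L ν lam) ^ (4 * N) := by
      rw [show 4 * N = 2 * (2 * N) by ring]; exact h.pow_even 1 0 _
    rw [comul_x, counit_x]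
    simp only [Fin.sum_univ_two, map_add, LinearMap.rTensor_tmul, LinearMap.mul'_apply,
      antipodeLin_x]
    rw [hn] at h4 e11 e10 ⊢
    rw [Nat.add_sub_cancel]
    by_cases hij : i = j
    · subst hij
      rw [← pow_succ, ← pow_succ, if_pos rfl, map_one, ← h4]
      fin_cases i
      · exact congrArg _ e10
      · exact (congrArg _ e11).trans (add_comm _ _)
    · rw [h.mul_pow_zero (by revert i j; decide), h.mul_pow_zero (by revert i j; decide),
        if_neg hij]
      simp
  | hmul a b ha hb =>
    rw [Bialgebra.comul_mul, Bialgebra.counit_mul, map_mul (algebraMap k _)]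
    have key : ∀ t u : SuzukiAlg k N L ν lam ⊗[k] SuzukiAlg k N L ν lam, ∀ r : k,
        LinearMap.mul' k _ (antipodeLin.rTensor _ t) = algebraMap k _ r →
        LinearMap.mul' k _ (antipodeLin.rTensor _ (t * u)) =
          algebraMap k _ r * LinearMap.mul' k _ (antipodeLin.rTensor _ u) := by
      intro t u r ht
      induction u using TensorProduct.induction_on with
      | zero => simp
      | add u v hu hv => rw [mul_add, map_add, map_add, hu, hv, map_add, map_add, mul_add]
      | tmul p q =>
        have : LinearMap.mul' k _ (antipodeLin.rTensor _ (t * p ⊗ₜ[k] q)) =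
            antipodeLin p * LinearMap.mul' k _ (antipodeLin.rTensor _ t) * q := by
          clear ht
          induction t using TensorProduct.induction_on with
          | zero => simp
          | add u v hu hv =>
            rw [add_mul, map_add, map_add, hu, hv, map_add, map_add, mul_add, add_mul]
          | tmul c d => simp [antipodeLin_mul, mul_assoc]
        rw [this, ht, ← Algebra.commutes, mul_assoc]
        simp
    rw [key _ _ _ ha, hb]
  | hadd a b ha hb => simp [ha, hb]

theorem antipode_right (a : SuzukiAlg k N L ν lam) :
    LinearMap.mul' k _ (antipodeLin.lTensor _ (Coalgebra.comul (R := k) a)) =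
      algebraMap k _ (Coalgebra.counit (R := k) a) := by
  induction a using induction with
  | hs r => simp [Algebra.TensorProduct.algebraMap_apply, antipodeLin]
  | hx i j =>
    have h := sat_x (k := k) (N := N) (L := L) (ν := ν) (lam := lam)
    have h4 := h.sum_pow_four
    have hN := NeZero.pos N
    obtain ⟨n, hn⟩ : ∃ n, 4 * N = n + 1 + 1 := ⟨4 * N - 2, by omega⟩
    have e11 : x 1 1 ^ (4 * N) = (x 0 0 : SuzukiAlg k N L ν lam) ^ (4 * N) := by
      rw [show 4 * N = 2 * (2 * N) by ring]; exact h.pow_even 1 1 _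
    have e10 : x 1 0 ^ (4 * N) = (x 0 1 : SuzukiAlg k N L ν lam) ^ (4 * N) := by
      rw [show 4 * N = 2 * (2 * N) by ring]; exact h.pow_even 1 0 _
    rw [comul_x, counit_x]
    simp only [Fin.sum_univ_two, map_add, LinearMap.lTensor_tmul, LinearMap.mul'_apply,
      antipodeLin_x]
    rw [hn] at h4 e11 e10 ⊢
    rw [Nat.add_sub_cancel]
    by_cases hij : i = j
    · subst hij
      rw [← pow_succ', ← pow_succ', if_pos rfl, map_one, ← h4]
      fin_cases i
      · rfl
      · exact (congrArg₂ _ e10 e11).trans (add_comm _ _)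
    · rw [pow_succ', pow_succ', ← mul_assoc, ← mul_assoc,
        h.mul_zero i 0 j 0 (by revert i j; decide), h.mul_zero i 1 j 1 (by revert i j; decide),
        if_neg hij]
      simp
  | hmul a b ha hb =>
    rw [Bialgebra.comul_mul, Bialgebra.counit_mul, map_mul (algebraMap k _)]
    have key : ∀ t u : SuzukiAlg k N L ν lam ⊗[k] SuzukiAlg k N L ν lam, ∀ r : k,
        LinearMap.mul' k _ (antipodeLin.lTensor _ u) = algebraMap k _ r →
        LinearMap.mul' k _ (antipodeLin.lTensor _ (t * u)) =
          LinearMap.mul' k _ (antipodeLin.lTensor _ t) * algebraMap k _ r := by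
      intro t u r hu
      induction t using TensorProduct.induction_on with
      | zero => simp
      | add t v ht hv => rw [add_mul, map_add, map_add, ht, hv, map_add, map_add, add_mul]
      | tmul p q =>
        have : LinearMap.mul' k _ (antipodeLin.lTensor _ (p ⊗ₜ[k] q * u)) =
            p * LinearMap.mul' k _ (antipodeLin.lTensor _ u) * antipodeLin q := by
          clear hu
          induction u using TensorProduct.induction_on with
          | zero => simp
          | add u v hu hv =>
            rw [mul_add, map_add, map_add, hu, hv, map_add, map_add, mul_add, add_mul]
          | tmul c d => simp [antipodeLin_mul, mul_assoc]
        rw [this, hu, mul_assoc, Algebra.commutes, ← mul_assoc]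
        simp
    rw [key _ _ _ hb, ha]
  | hadd a b ha hb => simp [ha, hb]

/-- The Hopf algebra structure, with antipode `S(x_{ij}) = x_{ji}^{4N-1}`. -/
instance : HopfAlgebra k (SuzukiAlg k N L ν lam) where
  antipode := antipodeLin
  mul_antipode_rTensor_comul := LinearMap.ext antipode_left
  mul_antipode_lTensor_comul := LinearMap.ext antipode_right

end SuzukiAlg

open SuzukiAlg

/-- `σ` extends the form `σ_{αβ}` on the coalgebra `C` spanned by the `x_{ij}`:
`σ(x_{ij}, x_{lm})` is `α` if `i ≠ j` and `(l, m) = (i, j)`, it is `β` if `i ≠ j` and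
`(l, m) = (j, i)`, and it is `0` otherwise. -/
def ExtendsSigma {k : Type*} [Field k] {N L : ℕ} {ν lam : ℤˣ} (α β : k)
    (σ : SuzukiAlg k N L ν lam ⊗[k] SuzukiAlg k N L ν lam →ₗ[k] k) : Prop :=
  ∀ i j l m : Fin 2, σ (x i j ⊗ₜ x l m) =
    if i ≠ j ∧ l = i ∧ m = j then α else if i ≠ j ∧ l = j ∧ m = i then β else 0

/-- `σ` extends the form `τ^λ_{γδ}` on the coalgebra `C` spanned by the `x_{ij}`:
`σ(x_{11}, x_{11}) = σ(x_{22}, x_{22}) = γ`, `σ(x_{11}, x_{22}) = δ`, `σ(x_{22}, x_{11}) = λ δ`,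
and all the other values are `0`. -/
def ExtendsTau {k : Type*} [Field k] {N L : ℕ} {ν lam : ℤˣ} (γ δ : k)
    (σ : SuzukiAlg k N L ν lam ⊗[k] SuzukiAlg k N L ν lam →ₗ[k] k) : Prop :=
  ∀ i j l m : Fin 2, σ (x i j ⊗ₜ x l m) =
    if i = j ∧ l = m then
      if i = l then γ else if i = 0 then δ else ((lam : ℤ) : k) * δ
    else 0

/-- `θ` extends the functional `θ_ω` on `C`, that is, `θ(x_{ij}) = δ_{ij} ω`. -/
def ExtendsTheta {k : Type*} [Field k] {N L : ℕ} {ν lam : ℤˣ} (ω : k)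
    (θ : SuzukiAlg k N L ν lam →ₗ[k] k) : Prop :=
  ∀ i j : Fin 2, θ (x i j) = if i = j then ω else 0

end

/-!
The proof works with comatrices, that is, square matrices `T` with `Δ(T_{ij}) = ∑ₘ T_{im} ⊗ T_{mj}`.
Suzuki's algebra is generated by one, so its entries and those of its Kronecker powers span the
algebra, and every identity in Sweedler notation becomes an identity between finite sums over matrix
indices (`SpannedByComatrices.hom_ext`).

*Existence and uniqueness of the braidings.* A braiding is the same as an algebra map from `A` to
its convolution dual, subject to multiplicativity in the second argument and to the commutation
rule. For fixed generators in the first argument, the prescribed values form matrices indexed by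
the second argument, which satisfy the defining relations and therefore extend to functionals
`p_{ij}` on `A` such that `a ↦ (p_{ij}(a))` is an anti-homomorphism. Both sides of each defining
relation between the `p_{ij}` are again entries of such multiplicative families, so the relation
holds in the convolution algebra as soon as it holds at the generators (`IsMultiplicative.sat`).
The commutation rule is closed under products in each argument, so it too is checked at the
generators (`existsUnique_braiding`).

*Coribbon elements.* The antipode satisfies `S² = 1`. Hence the Drinfeld functional
`u(x) = ∑ σ(x₍₂₎, S(x₍₁₎))` is central and is itself a coribbon element of the bialgebra
(`IsBraiding.drinfeld_isCoribbon`). Two coribbon elements differ by a central character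
(`IsCoribbon.exists_algHom`, `IsCoribbon.mul_algHom`). Central functionals act on the generators
by a scalar, by a comparison of `x₁₁`, `x₂₂` and `x₁₂` in two-dimensional representations, so the
central characters are `x_{ij} ↦ c δ_{ij}` with `c^{2N} = 1`. This gives all coribbon elements of
the bialgebra. As `u ∘ S` is a coribbon element with the same values as `u` at the generators, it
is `u`; and `(u * η) ∘ S = (η ∘ S) * u`, so that `u * η` is `S`-invariant exactly if `c² = 1`
(`coribbon_classification`). It remains to compute `u` at the generators: the scalar is `β⁻¹` for
`σ_{αβ}` and `γ⁻¹` for `τ_{γδ}`.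
-/

/-! ### Comatrices -/

section Comatrix

open WithConv Coalgebra

variable {k : Type*} [Field k]

/-- A square matrix `T` with entries in a coalgebra is a comatrix if
`Δ(T_{ij}) = ∑ₘ T_{im} ⊗ T_{mj}` and `ε(T_{ij}) = δ_{ij}`. -/
structure IsComatrix (k : Type*) [Field k] {C : Type*} [AddCommMonoid C] [Module k C]
    [Coalgebra k C] {ι : Type*} [Fintype ι] [DecidableEq ι] (T : ι → ι → C) : Prop where
  comul : ∀ i j, comul (R := k) (T i j) = ∑ m, T i m ⊗ₜ[k] T m j
  counit : ∀ i j, counit (R := k) (T i j) = if i = j then 1 else 0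

/-- The coalgebra `C` is spanned by the entries of its comatrices. Every coalgebra over a field has
this property, but only the case of an algebra generated by a comatrix is used below. It turns
an identity in Sweedler notation into an identity between finite sums over matrix indices. -/
class SpannedByComatrices (k C : Type*) [Field k] [AddCommMonoid C] [Module k C]
    [Coalgebra k C] : Prop where
  span_eq_top : Submodule.span k
    {c : C | ∃ (ι : Type) (_ : Fintype ι) (_ : DecidableEq ι) (T : ι → ι → C),
      IsComatrix k T ∧ ∃ i j, T i j = c} = ⊤

namespace IsComatrix

variable {ι κ : Type*} [Fintype ι] [DecidableEq ι] [Fintype κ] [DecidableEq κ]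

section Coalgebra

variable {C D R : Type*} [AddCommMonoid C] [Module k C] [Coalgebra k C]
  [AddCommMonoid D] [Module k D] [Coalgebra k D] [Semiring R] [Algebra k R]
  {T : ι → ι → C} {U : κ → κ → D}

/-- On the entries of a comatrix, the convolution product is the product of matrices. -/
theorem conv_apply (hT : IsComatrix k T) (f g : WithConv (C →ₗ[k] R)) (i j : ι) :
    (f * g) (T i j) = ∑ m, f (T i m) * g (T m j) := by
  simp [hT.comul]

theorem one_apply (hT : IsComatrix k T) (i j : ι) :
    (1 : WithConv (C →ₗ[k] R)) (T i j) = if i = j then 1 else 0 := by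
  simp [hT.counit, apply_ite (algebraMap k R)]

theorem tmul (hT : IsComatrix k T) (hU : IsComatrix k U) :
    IsComatrix k (fun p q : ι × κ => T p.1 q.1 ⊗ₜ[k] U p.2 q.2) where
  comul p q := by
    rw [TensorProduct.comul_tmul, hT.comul, hU.comul, Fintype.sum_prod_type]
    simp only [TensorProduct.sum_tmul, TensorProduct.tmul_sum, map_sum,
      TensorProduct.AlgebraTensorModule.tensorTensorTensorComm_tmul]
    exact Finset.sum_comm
  counit p q := by
    rw [TensorProduct.counit_tmul, hT.counit, hU.counit]
    simp only [Prod.ext_iff, smul_eq_mul]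
    split_ifs <;> simp_all

theorem conv_tmul_apply (hT : IsComatrix k T) (hU : IsComatrix k U)
    (f g : WithConv (C ⊗[k] D →ₗ[k] R)) (i j : ι) (a b : κ) :
    (f * g) (T i j ⊗ₜ U a b) = ∑ m, ∑ n, f (T i m ⊗ₜ U a n) * g (T m j ⊗ₜ U n b) := by
  rw [← Fintype.sum_prod_type']
  exact (hT.tmul hU).conv_apply f g (i, a) (j, b)

theorem one_tmul_apply (hT : IsComatrix k T) (hU : IsComatrix k U) (i j : ι) (a b : κ) :
    (1 : WithConv (C ⊗[k] D →ₗ[k] R)) (T i j ⊗ₜ U a b) =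
      (if i = j then 1 else 0) * (if a = b then 1 else 0) := by
  have := (hT.tmul hU).one_apply (R := R) (i, a) (j, b)
  simp only [Prod.mk.injEq] at this
  rw [this]
  split_ifs <;> simp_all

end Coalgebra

section Bialgebra

variable {A : Type*} [Ring A] [Bialgebra k A] {T : ι → ι → A} {U : κ → κ → A}

/-- The Kronecker product of two comatrices over a bialgebra is a comatrix. -/
theorem mul (hT : IsComatrix k T) (hU : IsComatrix k U) :
    IsComatrix k (fun p q : ι × κ => T p.1 q.1 * U p.2 q.2) where
  comul p q := by
    rw [Bialgebra.comul_mul, hT.comul, hU.comul, Fintype.sum_prod_type]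
    simp [Finset.sum_mul_sum]
  counit p q := by
    rw [Bialgebra.counit_mul, hT.counit, hU.counit]
    simp only [Prod.ext_iff]
    split_ifs <;> simp_all

theorem one : IsComatrix k (fun _ _ : Fin 1 => (1 : A)) where
  comul i j := by simp [Algebra.TensorProduct.one_def]
  counit i j := by simp [Subsingleton.elim i j]

end Bialgebra

section HopfAlgebra

open HopfAlgebra

variable {A : Type*} [Ring A] [HopfAlgebra k A] {T : ι → ι → A}

theorem sum_antipode_mul (hT : IsComatrix k T) (i j : ι) :
    ∑ m, antipode k (T i m) * T m j = if i = j then 1 else 0 := by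
  have := mul_antipode_rTensor_comul_apply (R := k) (T i j)
  rw [hT.comul, hT.counit] at this
  simpa [apply_ite (algebraMap k A)] using this

theorem sum_mul_antipode (hT : IsComatrix k T) (i j : ι) :
    ∑ m, T i m * antipode k (T m j) = if i = j then 1 else 0 := by
  have := mul_antipode_lTensor_comul_apply (R := k) (T i j)
  rw [hT.comul, hT.counit] at this
  simpa [apply_ite (algebraMap k A)] using this

/-- The matrices `Δ(S(T))` and `(1 ⊗ S(T)) (S(T) ⊗ 1)` over `A ⊗ A` are both inverse to
`Δ(T) = (T ⊗ 1) (1 ⊗ T)`, so that they agree. -/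
theorem antipode (hT : IsComatrix k T) :
    IsComatrix k (fun i j => HopfAlgebra.antipode k (T j i)) where
  comul i j := by
    let Δ : A → A ⊗[k] A := fun a => Coalgebra.comul (R := k) a
    let M : Matrix ι ι (A ⊗[k] A) := .of fun i j => Δ (T i j)
    let M' : Matrix ι ι (A ⊗[k] A) := .of fun i j => Δ (HopfAlgebra.antipode k (T i j))
    let T₁ : Matrix ι ι (A ⊗[k] A) := .of fun i j => T i j ⊗ₜ 1
    let T₂ : Matrix ι ι (A ⊗[k] A) := .of fun i j => 1 ⊗ₜ T i j
    let S₁ : Matrix ι ι (A ⊗[k] A) := .of fun i j => HopfAlgebra.antipode k (T i j) ⊗ₜ 1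
    let S₂ : Matrix ι ι (A ⊗[k] A) := .of fun i j => 1 ⊗ₜ HopfAlgebra.antipode k (T i j)
    have hM : M = T₁ * T₂ := by
      ext i j
      simp [M, T₁, T₂, Matrix.mul_apply, Δ, hT.comul]
    have h₁ : T₁ * S₁ = 1 := by
      ext i j
      simp only [T₁, S₁, Matrix.mul_apply, Matrix.of_apply, Algebra.TensorProduct.tmul_mul_tmul,
        mul_one, ← TensorProduct.sum_tmul, hT.sum_mul_antipode, Matrix.one_apply]
      split_ifs <;> simp [Algebra.TensorProduct.one_def]
    have h₂ : T₂ * S₂ = 1 := by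
      ext i j
      simp only [T₂, S₂, Matrix.mul_apply, Matrix.of_apply, Algebra.TensorProduct.tmul_mul_tmul,
        mul_one, ← TensorProduct.tmul_sum, hT.sum_mul_antipode, Matrix.one_apply]
      split_ifs <;> simp [Algebra.TensorProduct.one_def]
    have hM' : M' * M = 1 := by
      ext i j
      simp only [M', M, Matrix.mul_apply, Matrix.of_apply, Δ, ← Bialgebra.comul_mul, ← map_sum,
        hT.sum_antipode_mul, Matrix.one_apply]
      split_ifs <;> simp
    have key : M' = S₂ * S₁ := by
      refine left_inv_eq_right_inv hM' ?_
      rw [hM, Matrix.mul_assoc, ← Matrix.mul_assoc T₂, h₂, Matrix.one_mul, h₁]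
    have := congrFun (congrFun key j) i
    simpa [M', S₁, S₂, Matrix.mul_apply, Δ] using this
  counit i j := by
    rw [counit_antipode, hT.counit]
    simp [eq_comm]

/-- If `S² = 1`, then `S` is also the antipode of the opposite algebra. -/
theorem sum_antipode_mul' (hS : ∀ a : A, HopfAlgebra.antipode k (HopfAlgebra.antipode k a) = a)
    (hT : IsComatrix k T) (i j : ι) :
    ∑ m, HopfAlgebra.antipode k (T m j) * T i m = if i = j then 1 else 0 := by
  have := congrArg (HopfAlgebra.antipode k) (hT.sum_antipode_mul i j)
  simpa [antipode_mul_antidistrib, hS, apply_ite (HopfAlgebra.antipode k)] using this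

end HopfAlgebra

end IsComatrix

namespace SpannedByComatrices

variable {C D V : Type*} [AddCommMonoid C] [Module k C] [Coalgebra k C] [SpannedByComatrices k C]
  [AddCommMonoid D] [Module k D] [Coalgebra k D] [SpannedByComatrices k D]
  [AddCommMonoid V] [Module k V]

theorem hom_ext {f g : C →ₗ[k] V}
    (h : ∀ (ι : Type) [Fintype ι] [DecidableEq ι] (T : ι → ι → C), IsComatrix k T →
      ∀ i j, f (T i j) = g (T i j)) : f = g := by
  refine LinearMap.ext_on (span_eq_top (k := k) (C := C)) ?_
  rintro _ ⟨ι, _, _, T, hT, i, j, rfl⟩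
  exact h ι T hT i j

theorem hom_ext_tmul {f g : C ⊗[k] D →ₗ[k] V}
    (h : ∀ (ι κ : Type) [Fintype ι] [DecidableEq ι] [Fintype κ] [DecidableEq κ] (T : ι → ι → C)
      (U : κ → κ → D), IsComatrix k T → IsComatrix k U →
      ∀ i j a b, f (T i j ⊗ₜ U a b) = g (T i j ⊗ₜ U a b)) : f = g := by
  apply TensorProduct.ext
  refine hom_ext fun ι _ _ T hT i j => hom_ext fun κ _ _ U hU a b => ?_
  exact h ι κ T U hT hU i j a b

end SpannedByComatrices

end Comatrix

/-! ### Braidings in terms of comatrices -/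

section Braiding

open WithConv Coalgebra HopfAlgebra

variable {k : Type*} [Field k] {ι κ : Type*} [Fintype ι] [DecidableEq ι] [Fintype κ]
  [DecidableEq κ]

theorem asScalar_conv_mul {C A : Type*} [AddCommMonoid C] [Module k C] [Coalgebra k C] [Ring A]
    [Algebra k A] (f g : WithConv (C →ₗ[k] k)) :
    toConv (asScalar A (f * g).ofConv) =
      toConv (asScalar A f.ofConv) * toConv (asScalar A g.ofConv) :=
  WithConv.ext (LinearMap.algHom_comp_convMul_distrib (Algebra.ofId k A) f g)

theorem asScalar_conv_one {C A : Type*} [AddCommMonoid C] [Module k C] [Coalgebra k C] [Ring A]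
    [Algebra k A] : toConv (asScalar A (1 : WithConv (C →ₗ[k] k)).ofConv) = 1 := rfl

theorem IsComatrix.asScalar_conv_apply {A : Type*} [Ring A] [Bialgebra k A] {T : ι → ι → A}
    (hT : IsComatrix k T) (f : A →ₗ[k] k) (g : A →ₗ[k] A) (i j : ι) :
    (toConv (asScalar A f) * toConv g) (T i j) = ∑ m, f (T i m) • g (T m j) := by
  rw [hT.conv_apply]
  simp [asScalar, Algebra.smul_def]

theorem IsComatrix.conv_asScalar_apply {A : Type*} [Ring A] [Bialgebra k A] {T : ι → ι → A}
    (hT : IsComatrix k T) (f : A →ₗ[k] k) (g : A →ₗ[k] A) (i j : ι) :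
    (toConv g * toConv (asScalar A f)) (T i j) = ∑ m, f (T m j) • g (T i m) := by
  rw [hT.conv_apply]
  simp [asScalar, Algebra.smul_def, Algebra.commutes]

/-- The functional `(x, y) ↦ σ(x, S(y))`. -/
def twistRight {A : Type*} [Ring A] [HopfAlgebra k A] (σ : A ⊗[k] A →ₗ[k] k) :
    A ⊗[k] A →ₗ[k] k :=
  σ ∘ₗ (antipode k).lTensor A

@[simp] theorem twistRight_tmul {A : Type*} [Ring A] [HopfAlgebra k A] (σ : A ⊗[k] A →ₗ[k] k)
    (x y : A) : twistRight σ (x ⊗ₜ y) = σ (x ⊗ₜ antipode k y) := rfl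

namespace IsBraiding

section Bialgebra

variable {A : Type*} [Ring A] [Bialgebra k A] {σ : A ⊗[k] A →ₗ[k] k}
  {T : ι → ι → A} {U : κ → κ → A}

/-- The commutation rule `∑ σ(x₍₁₎, y₍₁₎) x₍₂₎ y₍₂₎ = ∑ σ(x₍₂₎, y₍₂₎) y₍₁₎ x₍₁₎`. -/
theorem comm_apply (hσ : IsBraiding σ) (hT : IsComatrix k T) (hU : IsComatrix k U)
    (i j : ι) (a b : κ) :
    ∑ m, ∑ n, σ (T i m ⊗ₜ U a n) • (T m j * U n b) =
      ∑ m, ∑ n, σ (T m j ⊗ₜ U n b) • (U a n * T i m) := by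
  have := congrArg (fun f => f.ofConv (T i j ⊗ₜ U a b)) hσ.comm
  simp only [hT.conv_tmul_apply hU] at this
  simpa [asScalar, Algebra.smul_def, Algebra.commutes] using this

theorem mul_left_apply (hσ : IsBraiding σ) (hU : IsComatrix k U) (x y : A) (a b : κ) :
    σ ((x * y) ⊗ₜ U a b) = ∑ n, σ (x ⊗ₜ U a n) * σ (y ⊗ₜ U n b) := by
  rw [hσ.mul_left, hU.conv_apply]
  rfl

theorem mul_right_apply (hσ : IsBraiding σ) (hT : IsComatrix k T) (y z : A) (i j : ι) :
    σ (T i j ⊗ₜ (y * z)) = ∑ m, σ (T i m ⊗ₜ z) * σ (T m j ⊗ₜ y) := by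
  rw [hσ.mul_right, hT.conv_apply]
  rfl

variable [SpannedByComatrices k A]

/-- The functional `σ(1, -)` is idempotent, and it is convolution-invertible. -/
theorem one_left (hσ : IsBraiding σ) (x : A) : σ (1 ⊗ₜ x) = counit (R := k) x := by
  obtain ⟨τ, hτ⟩ := hσ.isUnit.exists_right_inv
  let f : WithConv (A →ₗ[k] k) := toConv (TensorProduct.curry σ 1)
  let g : WithConv (A →ₗ[k] k) := toConv (TensorProduct.curry τ.ofConv 1)
  have hff : f * f = f := by
    ext y
    have := hσ.mul_left 1 1 y
    rw [mul_one] at this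
    exact this.symm
  have hfg : f * g = 1 := by
    apply WithConv.ext
    refine SpannedByComatrices.hom_ext fun ι _ _ T hT i j => ?_
    have := congrArg (fun f => f.ofConv (1 ⊗ₜ T i j)) hτ
    simp only [IsComatrix.one.conv_tmul_apply hT _ _ 0 0, IsComatrix.one.one_tmul_apply hT 0 0]
      at this
    rw [hT.conv_apply, hT.one_apply]
    simpa [f, g] using this
  have hf : f = 1 := by
    calc f = f * (f * g) := by rw [hfg, mul_one]
      _ = 1 := by rw [← mul_assoc, hff, hfg]
  have := congrArg (fun f => f.ofConv x) hf
  simpa [f] using this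

theorem one_right (hσ : IsBraiding σ) (x : A) : σ (x ⊗ₜ 1) = counit (R := k) x := by
  obtain ⟨τ, hτ⟩ := hσ.isUnit.exists_right_inv
  let f : WithConv (A →ₗ[k] k) := toConv ((TensorProduct.curry σ).flip 1)
  let g : WithConv (A →ₗ[k] k) := toConv ((TensorProduct.curry τ.ofConv).flip 1)
  have hff : f * f = f := by
    ext y
    have := hσ.mul_right y 1 1
    rw [mul_one] at this
    exact this.symm
  have hfg : f * g = 1 := by
    apply WithConv.ext
    refine SpannedByComatrices.hom_ext fun ι _ _ T hT i j => ?_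
    have := congrArg (fun f => f.ofConv (T i j ⊗ₜ 1)) hτ
    simp only [hT.conv_tmul_apply IsComatrix.one _ _ i j 0 0,
      hT.one_tmul_apply IsComatrix.one i j 0 0] at this
    rw [hT.conv_apply, hT.one_apply]
    simpa [f, g] using this
  have hf : f = 1 := by
    calc f = f * (f * g) := by rw [hfg, mul_one]
      _ = 1 := by rw [← mul_assoc, hff, hfg]
  have := congrArg (fun f => f.ofConv x) hf
  simpa [f] using this

end Bialgebra

section HopfAlgebra

variable {A : Type*} [Ring A] [HopfAlgebra k A] [SpannedByComatrices k A]
  {σ : A ⊗[k] A →ₗ[k] k} {T : ι → ι → A} {U : κ → κ → A}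

/-- If `S² = 1`, then `σ⁻¹(x, y) = σ(x, S(y))`. For a general antipode it is `S⁻¹` that inverts `σ`
in the second argument, which is an anti-homomorphism for the convolution product. -/
theorem inverse_eq_twistRight (hσ : IsBraiding σ)
    (hS : ∀ a : A, antipode k (antipode k a) = a) :
    Ring.inverse (toConv σ) = toConv (twistRight σ) := by
  have h : toConv σ * toConv (twistRight σ) = 1 := by
    apply WithConv.ext
    refine SpannedByComatrices.hom_ext_tmul fun ι κ _ _ _ _ T U hT hU i j a b => ?_
    rw [hT.conv_tmul_apply hU, hT.one_tmul_apply hU, Finset.sum_comm]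
    simp only [twistRight_tmul, ← hσ.mul_right_apply hT, ← map_sum, ← TensorProduct.tmul_sum,
      hU.sum_antipode_mul' hS]
    split_ifs <;> simp [hσ.one_right, hT.counit, *]
  obtain ⟨u, hu⟩ := hσ.isUnit
  rw [← hu] at h ⊢
  rw [Ring.inverse_unit]
  exact Units.inv_eq_of_mul_eq_one_right h

/-- `σ(S(x), y) = σ⁻¹(x, y) = σ(x, S(y))`. -/
theorem antipode_left (hσ : IsBraiding σ) (hS : ∀ a : A, antipode k (antipode k a) = a) (x y : A) :
    σ (antipode k x ⊗ₜ y) = σ (x ⊗ₜ antipode k y) := by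
  have h : toConv σ * toConv (σ ∘ₗ (antipode k).rTensor A) = 1 := by
    apply WithConv.ext
    refine SpannedByComatrices.hom_ext_tmul fun ι κ _ _ _ _ T U hT hU i j a b => ?_
    rw [hT.conv_tmul_apply hU, hT.one_tmul_apply hU]
    simp only [LinearMap.comp_apply, LinearMap.rTensor_tmul, ← hσ.mul_left_apply hU, ← map_sum,
      ← TensorProduct.sum_tmul, hT.sum_mul_antipode]
    split_ifs <;> simp [hσ.one_left, hU.counit, *]
  have h' := hσ.inverse_eq_twistRight hS
  obtain ⟨u, hu⟩ := hσ.isUnit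
  rw [← hu] at h h'
  rw [Ring.inverse_unit] at h'
  have := (Units.inv_eq_of_mul_eq_one_right h).symm.trans h'
  exact congrArg (fun f => f.ofConv (x ⊗ₜ y)) this

end HopfAlgebra

end IsBraiding
end Braiding

/-! ### The Drinfeld functional -/

section Drinfeld

open WithConv Coalgebra HopfAlgebra

variable {k : Type*} [Field k] {A : Type*} [Ring A] [HopfAlgebra k A]
  {ι κ : Type*} [Fintype ι] [DecidableEq ι] [Fintype κ] [DecidableEq κ]
  {σ : A ⊗[k] A →ₗ[k] k} {T : ι → ι → A} {U : κ → κ → A}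

theorem sum_rotate_three {M α₁ α₂ α₃ : Type*} [AddCommMonoid M] [Fintype α₁] [Fintype α₂]
    [Fintype α₃] (F : α₁ → α₂ → α₃ → M) :
    ∑ a, ∑ b, ∑ c, F a b c = ∑ c, ∑ a, ∑ b, F a b c :=
  (Finset.sum_congr rfl fun _ _ => Finset.sum_comm).trans Finset.sum_comm

theorem sum_rotate_four {M α₁ α₂ α₃ α₄ : Type*} [AddCommMonoid M] [Fintype α₁] [Fintype α₂]
    [Fintype α₃] [Fintype α₄] (F : α₁ → α₂ → α₃ → α₄ → M) :
    ∑ a, ∑ b, ∑ c, ∑ d, F a b c d = ∑ d, ∑ a, ∑ b, ∑ c, F a b c d :=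
  (Finset.sum_congr rfl fun _ _ => sum_rotate_three _).trans Finset.sum_comm

/-- The Drinfeld functional `u(x) = ∑ σ(x₍₂₎, S(x₍₁₎))`. -/
def drinfeld (σ : A ⊗[k] A →ₗ[k] k) : A →ₗ[k] k :=
  σ ∘ₗ (TensorProduct.comm k A A).toLinearMap ∘ₗ (antipode k).rTensor A ∘ₗ comul

/-- The functional `v(x) = ∑ σ(x₍₂₎, x₍₁₎)`, the convolution inverse of the Drinfeld functional
if `S² = 1`. -/
def drinfeldInv (σ : A ⊗[k] A →ₗ[k] k) : A →ₗ[k] k :=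
  σ ∘ₗ (TensorProduct.comm k A A).toLinearMap ∘ₗ comul

theorem drinfeld_apply (σ : A ⊗[k] A →ₗ[k] k) (hT : IsComatrix k T) (i j : ι) :
    drinfeld σ (T i j) = ∑ m, σ (T m j ⊗ₜ antipode k (T i m)) := by
  simp [drinfeld, hT.comul]

theorem drinfeldInv_apply (σ : A ⊗[k] A →ₗ[k] k) (hT : IsComatrix k T) (i j : ι) :
    drinfeldInv σ (T i j) = ∑ m, σ (T m j ⊗ₜ T i m) := by
  simp [drinfeldInv, hT.comul]

namespace IsBraiding

/-- `∑ u(x₍₂₎) x₍₃₎ S(x₍₁₎) = u(x)`: the commutation rule, applied to the pair `(x₍₃₎, S(x₍₁₎))`,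
turns the left-hand side into a sum in which `S(x₍₂₎) x₍₃₎` cancels. -/
theorem sum_drinfeld_smul_mul_antipode (hσ : IsBraiding σ) (hT : IsComatrix k T) (i j : ι) :
    ∑ m, (∑ p, drinfeld σ (T m p) • T p j) * antipode k (T i m) =
      algebraMap k A (drinfeld σ (T i j)) := by
  calc ∑ m, (∑ p, drinfeld σ (T m p) • T p j) * antipode k (T i m)
      = ∑ q, ∑ p, ∑ m, σ (T q p ⊗ₜ antipode k (T m q)) • (T p j * antipode k (T i m)) := by
        simp only [drinfeld_apply σ hT, Finset.sum_smul, Finset.sum_mul, smul_mul_assoc]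
        rw [Finset.sum_comm]
        refine (Finset.sum_congr rfl fun p _ => Finset.sum_comm).trans ?_
        exact Finset.sum_comm
    _ = ∑ q, ∑ p, ∑ m, σ (T p j ⊗ₜ antipode k (T i m)) • (antipode k (T m q) * T q p) :=
        Finset.sum_congr rfl fun q _ => hσ.comm_apply hT hT.antipode q j q i
    _ = ∑ p, ∑ m, σ (T p j ⊗ₜ antipode k (T i m)) • ∑ q, antipode k (T m q) * T q p := by
        rw [Finset.sum_comm]
        refine Finset.sum_congr rfl fun p _ => ?_
        rw [Finset.sum_comm]
        simp only [Finset.smul_sum]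
    _ = algebraMap k A (drinfeld σ (T i j)) := by
        simp [hT.sum_antipode_mul, drinfeld_apply σ hT, Algebra.algebraMap_eq_smul_one]

/-- If `S² = 1`, then the Drinfeld functional is central. -/
theorem drinfeld_central (hσ : IsBraiding σ) (hS : ∀ a : A, antipode k (antipode k a) = a)
    (hT : IsComatrix k T) (i j : ι) :
    ∑ m, drinfeld σ (T i m) • T m j = ∑ m, drinfeld σ (T m j) • T i m := by
  calc ∑ p, drinfeld σ (T i p) • T p j
      = ∑ m, (∑ p, drinfeld σ (T m p) • T p j) * ∑ l, antipode k (T l m) * T i l := by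
        simp [hT.sum_antipode_mul' hS]
    _ = ∑ l, (∑ m, (∑ p, drinfeld σ (T m p) • T p j) * antipode k (T l m)) * T i l := by
        simp only [Finset.mul_sum, ← mul_assoc]
        rw [Finset.sum_comm]
        simp only [Finset.sum_mul]
    _ = ∑ m, drinfeld σ (T m j) • T i m := by
        simp only [hσ.sum_drinfeld_smul_mul_antipode hT]
        simp only [Algebra.smul_def]

theorem drinfeld_central_map (hσ : IsBraiding σ) (hS : ∀ a : A, antipode k (antipode k a) = a)
    (hT : IsComatrix k T) (f : A →ₗ[k] k) (i j : ι) :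
    ∑ m, drinfeld σ (T i m) * f (T m j) = ∑ m, f (T i m) * drinfeld σ (T m j) := by
  have := congrArg f (hσ.drinfeld_central hS hT i j)
  simpa [mul_comm] using this

/-- The inverse form of the commutation rule:
`∑ σ⁻¹(x₍₁₎, y₍₁₎) y₍₂₎ x₍₂₎ = ∑ x₍₁₎ y₍₁₎ σ⁻¹(x₍₂₎, y₍₂₎)`. -/
theorem inverse_comm_apply [SpannedByComatrices k A] (hσ : IsBraiding σ)
    (hS : ∀ a : A, antipode k (antipode k a) = a) (hT : IsComatrix k T) (hU : IsComatrix k U)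
    (i j : ι) (a b : κ) :
    ∑ m, ∑ n, σ (T i m ⊗ₜ antipode k (U a n)) • (U n b * T m j) =
      ∑ m, ∑ n, σ (T m j ⊗ₜ antipode k (U n b)) • (T i m * U a n) := by
  have h := hσ.comm
  set s : WithConv (A ⊗[k] A →ₗ[k] A) := toConv (asScalar A σ)
  let t : WithConv (A ⊗[k] A →ₗ[k] A) := toConv (asScalar A (twistRight σ))
  have hst : s * t = 1 := by
    rw [← asScalar_conv_one, ← Ring.mul_inverse_cancel _ hσ.isUnit, asScalar_conv_mul,
      hσ.inverse_eq_twistRight hS]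
  have hts : t * s = 1 := by
    rw [← asScalar_conv_one, ← Ring.inverse_mul_cancel _ hσ.isUnit, asScalar_conv_mul,
      hσ.inverse_eq_twistRight hS]
  have key : t * toConv (LinearMap.mul' k A ∘ₗ (TensorProduct.comm k A A).toLinearMap) =
      toConv (LinearMap.mul' k A) * t := by
    calc _ = t * (toConv (LinearMap.mul' k A ∘ₗ (TensorProduct.comm k A A).toLinearMap) * s) *
          t := by
          rw [mul_assoc, mul_assoc, hst, mul_one]
      _ = _ := by rw [← h, ← mul_assoc, hts, one_mul]
  have := congrArg (fun f => f.ofConv (T i j ⊗ₜ U a b)) key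
  simp only [hT.conv_tmul_apply hU] at this
  simpa [t, asScalar, Algebra.smul_def, Algebra.commutes] using this

/-- If `S² = 1`, then `u` is convolution-invertible: by centrality `∑ u(x₍₁₎) σ(x₍₃₎, x₍₂₎)` equals
`∑ u(x₍₂₎) σ(x₍₃₎, x₍₁₎)`, which is `∑ σ(x₍₃₎, x₍₁₎ S(x₍₂₎))`. -/
theorem drinfeld_mul_inv [SpannedByComatrices k A] (hσ : IsBraiding σ)
    (hS : ∀ a : A, antipode k (antipode k a) = a) :
    toConv (drinfeld σ) * toConv (drinfeldInv σ) = 1 := by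
  apply WithConv.ext
  refine SpannedByComatrices.hom_ext fun ι _ _ T hT i j => ?_
  rw [hT.conv_apply, hT.one_apply]
  change ∑ m, drinfeld σ (T i m) * drinfeldInv σ (T m j) = _
  calc ∑ m, drinfeld σ (T i m) * drinfeldInv σ (T m j)
      = ∑ p, σ (T p j ⊗ₜ ∑ m, drinfeld σ (T i m) • T m p) := by
        simp only [drinfeldInv_apply σ hT, Finset.mul_sum, TensorProduct.tmul_sum,
          TensorProduct.tmul_smul, map_sum, map_smul, smul_eq_mul]
        exact Finset.sum_comm
    _ = ∑ p, σ (T p j ⊗ₜ ∑ m, drinfeld σ (T m p) • T i m) := by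
        simp only [hσ.drinfeld_central hS hT]
    _ = ∑ m, ∑ q, ∑ p, σ (T q p ⊗ₜ antipode k (T m q)) * σ (T p j ⊗ₜ T i m) := by
        simp only [drinfeld_apply σ hT, TensorProduct.tmul_sum,
          TensorProduct.tmul_smul, map_sum, map_smul, smul_eq_mul, Finset.sum_mul]
        rw [Finset.sum_comm]
        exact Finset.sum_congr rfl fun m _ => Finset.sum_comm
    _ = ∑ q, σ (T q j ⊗ₜ ∑ m, T i m * antipode k (T m q)) := by
        simp only [← hσ.mul_right_apply hT, TensorProduct.tmul_sum, map_sum]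
        exact Finset.sum_comm
    _ = if i = j then 1 else 0 := by
        simp only [hT.sum_mul_antipode]
        rw [Finset.sum_eq_single i (by simp +contextual [eq_comm]) (by simp)]
        simp [hσ.one_right, hT.counit]

/-- `u(x y) = ∑ σ⁻¹(x₍₁₎, y₍₁₎) u(x₍₂₎) u(y₍₂₎) σ⁻¹(y₍₃₎, x₍₃₎)`. The multiplicativity of `σ` splits
`u(x y) = ∑ σ(x₍₂₎ y₍₂₎, S(y₍₁₎) S(x₍₁₎))` into a sum containing `u` on a factor of `x`. Centrality
of `u` moves it out, the commutation rule for `σ⁻¹` then brings the remaining factors of `y` into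
the form of `u`, and centrality is used again to restore the order of the factors. -/
theorem drinfeld_mul [SpannedByComatrices k A] (hσ : IsBraiding σ)
    (hS : ∀ a : A, antipode k (antipode k a) = a) (hT : IsComatrix k T) (hU : IsComatrix k U)
    (i j : ι) (a b : κ) :
    drinfeld σ (T i j * U a b) = ∑ m, ∑ n, ∑ p, ∑ q, σ (T i m ⊗ₜ antipode k (U a n)) *
      (drinfeld σ (T m p) * drinfeld σ (U n q)) * σ (U q b ⊗ₜ antipode k (T p j)) := by
  let f (q : κ) : A →ₗ[k] k := TensorProduct.curry σ (U q b) ∘ₗ antipode k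
  calc drinfeld σ (T i j * U a b)
      = ∑ m, ∑ n, σ ((T m j * U n b) ⊗ₜ (antipode k (U a n) * antipode k (T i m))) := by
        refine (drinfeld_apply σ (hT.mul hU) (i, a) (j, b)).trans ?_
        rw [Fintype.sum_prod_type]
        simp only [antipode_mul_antidistrib]
    _ = ∑ m, ∑ n, ∑ p, ∑ q, (∑ r, σ (T m p ⊗ₜ antipode k (T r m)) *
          σ (U n q ⊗ₜ antipode k (T i r))) * σ ((T p j * U q b) ⊗ₜ antipode k (U a n)) := by
        refine Finset.sum_congr rfl fun m _ => Finset.sum_congr rfl fun n _ => ?_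
        refine (hσ.mul_right_apply (hT.mul hU) _ _ (m, n) (j, b)).trans ?_
        rw [Fintype.sum_prod_type]
        refine Finset.sum_congr rfl fun p _ => Finset.sum_congr rfl fun q _ => ?_
        rw [hσ.mul_left_apply hT.antipode (T m p) (U n q) m i]
    _ = ∑ n, ∑ q, ∑ r, ∑ p, (∑ m, σ (T m p ⊗ₜ antipode k (T r m))) *
          (σ (U n q ⊗ₜ antipode k (T i r)) * σ ((T p j * U q b) ⊗ₜ antipode k (U a n))) := by
        simp only [Finset.sum_mul]
        rw [Finset.sum_comm]
        refine Finset.sum_congr rfl fun n _ => ?_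
        refine (Finset.sum_congr rfl fun m _ => Finset.sum_comm).trans ?_
        rw [Finset.sum_comm]
        refine Finset.sum_congr rfl fun q _ => ?_
        refine (Finset.sum_congr rfl fun m _ => Finset.sum_comm).trans ?_
        rw [Finset.sum_comm]
        refine Finset.sum_congr rfl fun r _ => ?_
        rw [Finset.sum_comm]
        simp only [mul_assoc]
    _ = ∑ n, ∑ q, ∑ r, σ (U n q ⊗ₜ antipode k (T i r)) *
          σ (((∑ p, drinfeld σ (T r p) • T p j) * U q b) ⊗ₜ antipode k (U a n)) := by
        refine Finset.sum_congr rfl fun n _ => Finset.sum_congr rfl fun q _ =>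
          Finset.sum_congr rfl fun r _ => ?_
        simp only [← drinfeld_apply σ hT, Finset.sum_mul, TensorProduct.sum_tmul, map_sum,
          smul_mul_assoc, ← TensorProduct.smul_tmul', map_smul, smul_eq_mul, Finset.mul_sum]
        exact Finset.sum_congr rfl fun p _ => mul_left_comm _ _ _
    _ = ∑ p, drinfeld σ (T p j) * ∑ n,
          σ ((∑ q, ∑ r, σ (U n q ⊗ₜ antipode k (T i r)) • (T r p * U q b)) ⊗ₜ
            antipode k (U a n)) := by
        simp only [hσ.drinfeld_central hS hT, Finset.sum_mul, TensorProduct.sum_tmul, map_sum,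
          smul_mul_assoc, ← TensorProduct.smul_tmul', map_smul, smul_eq_mul, Finset.mul_sum]
        rw [sum_rotate_four]
        refine Finset.sum_congr rfl fun p _ => Finset.sum_congr rfl fun n _ =>
          Finset.sum_congr rfl fun q _ => Finset.sum_congr rfl fun r _ => mul_left_comm _ _ _
    _ = ∑ p, drinfeld σ (T p j) * ∑ n, ∑ q, ∑ r, σ (U q b ⊗ₜ antipode k (T r p)) *
          ∑ s, σ (U n q ⊗ₜ antipode k (U s n)) * σ (T i r ⊗ₜ antipode k (U a s)) := by
        simp only [hσ.inverse_comm_apply hS hU hT, TensorProduct.sum_tmul, map_sum,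
          ← TensorProduct.smul_tmul', map_smul, smul_eq_mul]
        simp only [hσ.mul_left_apply hU.antipode]
    _ = ∑ r, ∑ s, ∑ q, (σ (T i r ⊗ₜ antipode k (U a s)) *
          (∑ n, σ (U n q ⊗ₜ antipode k (U s n)))) *
            ∑ p, f q (T r p) * drinfeld σ (T p j) := by
        simp only [Finset.mul_sum, Finset.sum_mul]
        rw [sum_rotate_four]
        refine Finset.sum_congr rfl fun r _ => ?_
        rw [sum_rotate_four]
        refine Finset.sum_congr rfl fun s _ => ?_
        rw [sum_rotate_three]
        refine Finset.sum_congr rfl fun q _ => Finset.sum_congr rfl fun p _ =>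
          Finset.sum_congr rfl fun n _ => ?_
        simp only [f, LinearMap.comp_apply, TensorProduct.curry_apply]
        ring
    _ = _ := by
        simp only [← drinfeld_apply σ hU, ← hσ.drinfeld_central_map hS hT]
        refine Finset.sum_congr rfl fun r _ => Finset.sum_congr rfl fun s _ => ?_
        simp only [Finset.mul_sum]
        rw [Finset.sum_comm]
        refine Finset.sum_congr rfl fun p _ => Finset.sum_congr rfl fun q _ => ?_
        simp only [f, LinearMap.comp_apply, TensorProduct.curry_apply]
        ring

end IsBraiding
end Drinfeld

/-! ### Coribbon elements and central characters -/

section CentralFunctional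

open WithConv Coalgebra HopfAlgebra

variable {k : Type*} [Field k]

/-- The linear functional `θ` is central: `∑ θ(x₍₁₎) x₍₂₎ = ∑ θ(x₍₂₎) x₍₁₎`. -/
def IsCentralFunctional {A : Type*} [Ring A] [Bialgebra k A] (θ : A →ₗ[k] k) : Prop :=
  Commute (toConv (asScalar A θ)) (toConv (LinearMap.id : A →ₗ[k] A))

/-- The linear functional `f ⊗ g` on `A ⊗ A`. -/
def tensorFunctional {A : Type*} [Ring A] [Algebra k A] (f g : A →ₗ[k] k) : A ⊗[k] A →ₗ[k] k :=
  LinearMap.mul' k k ∘ₗ TensorProduct.map f g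

@[simp] theorem tensorFunctional_tmul {A : Type*} [Ring A] [Algebra k A] (f g : A →ₗ[k] k)
    (x y : A) : tensorFunctional f g (x ⊗ₜ y) = f x * g y := rfl

/-- The linear functional `θ ⊗ θ` on `A ⊗ A`. -/
abbrev tensorSquare {A : Type*} [Ring A] [Algebra k A] (θ : A →ₗ[k] k) : A ⊗[k] A →ₗ[k] k :=
  tensorFunctional θ θ

section Bialgebra

variable {A : Type*} [Ring A] [Bialgebra k A]

theorem conv_comp_mul (f g : WithConv (A →ₗ[k] k)) :
    toConv ((f * g).ofConv ∘ₗ LinearMap.mul' k A) =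
      toConv (f.ofConv ∘ₗ LinearMap.mul' k A) * toConv (g.ofConv ∘ₗ LinearMap.mul' k A) :=
  WithConv.ext (LinearMap.convMul_comp_coalgHom_distrib f g (Bialgebra.mulCoalgHom k A))

theorem conv_one_comp_mul :
    toConv ((1 : WithConv (A →ₗ[k] k)).ofConv ∘ₗ LinearMap.mul' k A) = 1 := by
  apply WithConv.ext
  ext x y
  simp [mul_comm]

namespace IsCentralFunctional

variable {ι κ : Type*} [Fintype ι] [DecidableEq ι] [Fintype κ] [DecidableEq κ]
  {T : ι → ι → A} {U : κ → κ → A} {θ : A →ₗ[k] k}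

theorem apply (h : IsCentralFunctional θ) (hT : IsComatrix k T) (i j : ι) :
    ∑ m, θ (T i m) • T m j = ∑ m, θ (T m j) • T i m := by
  have := congrArg (fun f => f.ofConv (T i j)) h.eq
  simp only [hT.asScalar_conv_apply, hT.conv_asScalar_apply] at this
  exact this

theorem of_apply [SpannedByComatrices k A]
    (h : ∀ (ι : Type) [Fintype ι] [DecidableEq ι] (T : ι → ι → A), IsComatrix k T →
      ∀ i j, ∑ m, θ (T i m) • T m j = ∑ m, θ (T m j) • T i m) : IsCentralFunctional θ := by
  apply WithConv.ext
  refine SpannedByComatrices.hom_ext fun ι _ _ T hT i j => ?_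
  rw [hT.asScalar_conv_apply, hT.conv_asScalar_apply]
  exact h ι T hT i j

theorem mul {f g : WithConv (A →ₗ[k] k)} (hf : IsCentralFunctional f.ofConv)
    (hg : IsCentralFunctional g.ofConv) : IsCentralFunctional (f * g).ofConv := by
  unfold IsCentralFunctional
  rw [asScalar_conv_mul]
  exact Commute.mul_left hf hg

theorem inv {u : (WithConv (A →ₗ[k] k))ˣ} (hu : IsCentralFunctional u.val.ofConv) :
    IsCentralFunctional u⁻¹.val.ofConv := by
  let v : (WithConv (A →ₗ[k] A))ˣ :=
    ⟨toConv (asScalar A u.val.ofConv), toConv (asScalar A u⁻¹.val.ofConv),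
      by rw [← asScalar_conv_mul, u.mul_inv, asScalar_conv_one],
      by rw [← asScalar_conv_mul, u.inv_mul, asScalar_conv_one]⟩
  exact Commute.units_inv_left (u := v) hu

variable [SpannedByComatrices k A]

/-- A central functional commutes with every functional. -/
theorem commute (h : IsCentralFunctional θ) (f : WithConv (A →ₗ[k] k)) :
    Commute (toConv θ) f := by
  apply WithConv.ext
  refine SpannedByComatrices.hom_ext fun ι _ _ T hT i j => ?_
  rw [hT.conv_apply, hT.conv_apply]
  have := congrArg f.ofConv (h.apply hT i j)
  simpa [mul_comm] using this

theorem tensorSquare_commute (h : IsCentralFunctional θ) (F : WithConv (A ⊗[k] A →ₗ[k] k)) :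
    Commute (toConv (tensorSquare θ)) F := by
  apply WithConv.ext
  refine SpannedByComatrices.hom_ext_tmul fun ι κ _ _ _ _ T U hT hU i j a b => ?_
  rw [hT.conv_tmul_apply hU, hT.conv_tmul_apply hU]
  have := congrArg₂ (fun x y => F.ofConv (x ⊗ₜ y)) (h.apply hT i j) (h.apply hU a b)
  simp only [TensorProduct.sum_tmul, TensorProduct.tmul_sum, map_sum,
    TensorProduct.tmul_smul, ← TensorProduct.smul_tmul', map_smul, smul_eq_mul] at this
  refine Eq.trans ?_ (this.trans ?_)
  · rw [Finset.sum_comm]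
    simp only [tensorFunctional_tmul, Finset.mul_sum]
    exact Finset.sum_congr rfl fun n _ => Finset.sum_congr rfl fun m _ => by ring
  · rw [Finset.sum_comm]
    simp only [tensorFunctional_tmul, Finset.mul_sum]
    exact Finset.sum_congr rfl fun m _ => Finset.sum_congr rfl fun n _ => by ring

end IsCentralFunctional

theorem tensorFunctional_conv_mul [SpannedByComatrices k A] (f g f' g' : WithConv (A →ₗ[k] k)) :
    toConv (tensorFunctional (f * f').ofConv (g * g').ofConv) =
      toConv (tensorFunctional f.ofConv g.ofConv) *
        toConv (tensorFunctional f'.ofConv g'.ofConv) := by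
  apply WithConv.ext
  refine SpannedByComatrices.hom_ext_tmul fun ι κ _ _ _ _ T U hT hU i j a b => ?_
  rw [hT.conv_tmul_apply hU]
  change (f * f') (T i j) * (g * g') (U a b) = _
  rw [hT.conv_apply, hU.conv_apply, Finset.sum_mul_sum]
  refine Finset.sum_congr rfl fun m _ => Finset.sum_congr rfl fun n _ => ?_
  simp only [tensorFunctional_tmul]
  ring

theorem algHom_comp_mul (η : A →ₐ[k] k) :
    η.toLinearMap ∘ₗ LinearMap.mul' k A = tensorSquare η.toLinearMap := by
  ext x y
  simp

variable {σ : A ⊗[k] A →ₗ[k] k} {θ θ' : A →ₗ[k] k}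

namespace IsCoribbon

theorem isCentralFunctional (h : IsCoribbon σ θ) : IsCentralFunctional θ := h.central

theorem map_mul_eq (h : IsCoribbon σ θ) : toConv (θ ∘ₗ LinearMap.mul' k A) =
    Ring.inverse (toConv σ) * toConv (tensorSquare θ) *
      toConv ((Ring.inverse (toConv σ)).ofConv ∘ₗ (TensorProduct.comm k A A).toLinearMap) :=
  h.map_mul

variable [SpannedByComatrices k A]

/-- The product of a coribbon element and a central character is a coribbon element. -/
theorem mul_algHom (h : IsCoribbon σ θ) (η : A →ₐ[k] k)
    (hη : IsCentralFunctional η.toLinearMap) (hu : IsUnit (toConv η.toLinearMap)) :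
    IsCoribbon σ (toConv θ * toConv η.toLinearMap).ofConv where
  isUnit := h.isUnit.mul hu
  central := (IsCentralFunctional.mul (f := toConv θ) (g := toConv η.toLinearMap)
    h.central hη).eq
  map_mul := by
    change _ = _ * toConv (tensorSquare _) * _
    rw [conv_comp_mul, tensorFunctional_conv_mul]
    change toConv (θ ∘ₗ LinearMap.mul' k A) * toConv (η.toLinearMap ∘ₗ LinearMap.mul' k A) = _
    rw [h.map_mul_eq, algHom_comp_mul, mul_assoc, ← (hη.tensorSquare_commute _).eq]
    simp only [mul_assoc]
  map_one := by
    have := IsComatrix.one.conv_apply (toConv θ) (toConv η.toLinearMap) 0 0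
    simpa [h.map_one] using this

/-- Two coribbon elements differ by a central character: `σ` drops out of the product rules since
`η ⊗ η` commutes with it. -/
theorem exists_algHom (h : IsCoribbon σ θ) (h' : IsCoribbon σ θ') :
    ∃ η : A →ₐ[k] k, IsCentralFunctional η.toLinearMap ∧
      toConv θ' = toConv θ * toConv η.toLinearMap := by
  obtain ⟨u, hu⟩ := h.isUnit
  let η : WithConv (A →ₗ[k] k) := u⁻¹.val * toConv θ'
  have hc : IsCentralFunctional η.ofConv :=
    IsCentralFunctional.mul (IsCentralFunctional.inv (by rw [hu]; exact h.central)) h'.central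
  have hθ' : toConv θ' = toConv θ * η := by rw [← hu, ← mul_assoc, u.mul_inv, one_mul]
  have hcancel : toConv (u⁻¹.val.ofConv ∘ₗ LinearMap.mul' k A) *
      toConv (θ ∘ₗ LinearMap.mul' k A) = 1 := by
    have := conv_comp_mul u⁻¹.val u.val
    rw [u.inv_mul, conv_one_comp_mul, hu] at this
    exact this.symm
  have hmul : toConv (η.ofConv ∘ₗ LinearMap.mul' k A) = toConv (tensorSquare η.ofConv) := by
    have e : toConv (θ ∘ₗ LinearMap.mul' k A) * toConv (η.ofConv ∘ₗ LinearMap.mul' k A) =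
        toConv (θ ∘ₗ LinearMap.mul' k A) * toConv (tensorSquare η.ofConv) := by
      have e₁ : toConv (θ' ∘ₗ LinearMap.mul' k A) =
          toConv (θ ∘ₗ LinearMap.mul' k A) * toConv (η.ofConv ∘ₗ LinearMap.mul' k A) := by
        rw [← conv_comp_mul (toConv θ) η, ← hθ']
      have e₂ : toConv (tensorSquare θ') =
          toConv (tensorSquare θ) * toConv (tensorSquare η.ofConv) := by
        rw [← tensorFunctional_conv_mul (toConv θ) (toConv θ) η η, ← hθ']
      rw [← e₁, h'.map_mul_eq, h.map_mul_eq, e₂]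
      simp only [mul_assoc, (hc.tensorSquare_commute _).eq]
    have := congrArg (toConv (u⁻¹.val.ofConv ∘ₗ LinearMap.mul' k A) * ·) e
    simpa only [← mul_assoc, hcancel, one_mul] using this
  have hone : η.ofConv 1 = 1 := by
    have := congrArg (fun f => f.ofConv 1) hθ'
    simp only [IsComatrix.one.conv_apply (toConv θ) η 0 0] at this
    simpa [h.map_one, h'.map_one] using this.symm
  refine ⟨AlgHom.ofLinearMap η.ofConv hone fun x y => ?_, hc, hθ'⟩
  exact congrArg (fun f => f.ofConv (x ⊗ₜ y)) hmul

end IsCoribbon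

end Bialgebra

section HopfAlgebra

variable {A : Type*} [Ring A] [HopfAlgebra k A] [SpannedByComatrices k A]
  {σ : A ⊗[k] A →ₗ[k] k} {θ : A →ₗ[k] k}

theorem conv_comp_antipode (f g : WithConv (A →ₗ[k] k)) :
    toConv ((f * g).ofConv ∘ₗ antipode k) =
      toConv (g.ofConv ∘ₗ antipode k) * toConv (f.ofConv ∘ₗ antipode k) := by
  apply WithConv.ext
  refine SpannedByComatrices.hom_ext fun ι _ _ T hT i j => ?_
  rw [hT.conv_apply]
  refine (hT.antipode.conv_apply f g j i).trans ?_
  simp [mul_comm]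

theorem isUnit_comp_antipode {f : WithConv (A →ₗ[k] k)} (hf : IsUnit f) :
    IsUnit (toConv (f.ofConv ∘ₗ antipode k)) := by
  obtain ⟨u, rfl⟩ := hf
  have h1 : toConv ((1 : WithConv (A →ₗ[k] k)).ofConv ∘ₗ antipode k) = 1 := by
    apply WithConv.ext
    ext x
    simp
  exact ⟨⟨_, toConv (u⁻¹.val.ofConv ∘ₗ antipode k), by rw [← conv_comp_antipode, u.inv_mul, h1],
    by rw [← conv_comp_antipode, u.mul_inv, h1]⟩, rfl⟩

theorem algHom_conv_mul_comp_antipode (η : A →ₐ[k] k) :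
    toConv η.toLinearMap * toConv (η.toLinearMap ∘ₗ antipode k) = 1 := by
  apply WithConv.ext
  refine SpannedByComatrices.hom_ext fun ι _ _ T hT i j => ?_
  rw [hT.conv_apply, hT.one_apply]
  simp only [AlgHom.toLinearMap_apply, LinearMap.comp_apply, ← map_mul, ← map_sum,
    hT.sum_mul_antipode]
  split_ifs <;> simp

/-- A character `η` is inverted by `η ∘ S`; centrality makes the one-sided inverse two-sided. -/
theorem isUnit_algHom {η : A →ₐ[k] k} (hη : IsCentralFunctional η.toLinearMap) :
    IsUnit (toConv η.toLinearMap) :=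
  ⟨⟨_, toConv (η.toLinearMap ∘ₗ antipode k), algHom_conv_mul_comp_antipode η,
    by rw [← (hη.commute _).eq, algHom_conv_mul_comp_antipode]⟩, rfl⟩

/-- If `S² = 1`, then the Drinfeld functional is a coribbon element of the bialgebra. -/
theorem IsBraiding.drinfeld_isCoribbon (hσ : IsBraiding σ)
    (hS : ∀ a : A, antipode k (antipode k a) = a) : IsCoribbon σ (drinfeld σ) := by
  have hc : IsCentralFunctional (drinfeld σ) :=
    .of_apply fun ι _ _ T hT => hσ.drinfeld_central hS hT
  refine ⟨⟨⟨_, toConv (drinfeldInv σ), hσ.drinfeld_mul_inv hS, ?_⟩, rfl⟩, hc, ?_, ?_⟩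
  · rw [← (hc.commute _).eq, hσ.drinfeld_mul_inv hS]
  · change _ = _ * toConv (tensorSquare _) * _
    rw [hσ.inverse_eq_twistRight hS]
    apply WithConv.ext
    refine SpannedByComatrices.hom_ext_tmul fun ι κ _ _ _ _ T U hT hU i j a b => ?_
    rw [hT.conv_tmul_apply hU]
    simp only [hT.conv_tmul_apply hU]
    refine (hσ.drinfeld_mul hS hT hU i j a b).trans ?_
    simp only [Finset.sum_mul]
    exact (sum_rotate_four _).trans (sum_rotate_four _)
  · have := drinfeld_apply σ (IsComatrix.one (k := k) (A := A)) 0 0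
    simpa [hσ.one_left] using this

/-- If `S² = 1`, then `θ ∘ S` is a coribbon element of the bialgebra for each coribbon
element `θ`. -/
theorem IsCoribbon.comp_antipode (h : IsCoribbon σ θ) (hσ : IsBraiding σ)
    (hS : ∀ a : A, antipode k (antipode k a) = a) : IsCoribbon σ (θ ∘ₗ antipode k) := by
  refine ⟨isUnit_comp_antipode h.isUnit, ?_, ?_, ?_⟩
  · refine IsCentralFunctional.of_apply fun ι _ _ T hT i j => ?_
    have := congrArg (antipode k) (h.isCentralFunctional.apply hT.antipode j i)
    simpa [hS] using this.symm
  · have hm := h.map_mul_eq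
    change _ = _ * toConv (tensorSquare _) * _
    rw [hσ.inverse_eq_twistRight hS] at hm ⊢
    apply WithConv.ext
    refine SpannedByComatrices.hom_ext_tmul fun ι κ _ _ _ _ T U hT hU i j a b => ?_
    have := congrArg (fun f => f.ofConv (antipode k (U a b) ⊗ₜ antipode k (T i j))) hm
    have e := (hU.antipode).conv_tmul_apply (R := k) hT.antipode
    simp only at e this
    rw [e] at this
    simp only [e] at this
    rw [hT.conv_tmul_apply hU]
    simp only [hT.conv_tmul_apply hU]
    simp only [LinearMap.comp_apply, LinearMap.mul'_apply, tensorFunctional_tmul,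
      ← antipode_mul_antidistrib, twistRight_tmul, LinearEquiv.coe_coe, TensorProduct.comm_tmul,
      hS, hσ.antipode_left hS] at this ⊢
    rw [this]
    simp only [Finset.sum_mul]
    rw [sum_rotate_four]
    refine Finset.sum_congr rfl fun p _ => ?_
    rw [sum_rotate_three]
    refine Finset.sum_congr rfl fun q _ => ?_
    rw [Finset.sum_comm]
    exact Finset.sum_congr rfl fun m _ => Finset.sum_congr rfl fun n _ => by ring
  · simp [h.map_one]

end HopfAlgebra
end CentralFunctional

/-! ### Comatrices and the antipode of Suzuki's algebras -/

namespace SuzukiAlg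

open WithConv Coalgebra HopfAlgebra

variable {k : Type*} [Field k] {N L : ℕ} {ν lam : ℤˣ}

theorem intCast_unit_mul_self {R : Type*} [Ring R] (u : ℤˣ) :
    ((u : ℤ) : R) * ((u : ℤ) : R) = 1 := by
  rcases Int.units_eq_one_or u with rfl | rfl <;> simp

theorem intCast_unit_mul (k : Type*) [Field k] {R : Type*} [Ring R] [Algebra k R] (u : ℤˣ)
    (a : R) : ((u : ℤ) : R) * a = ((u : ℤ) : k) • a := by
  rw [Algebra.smul_def, map_intCast]

/-- The element `y₁₁^{4N} + y₁₂^{4N}` is `1`, and each `yᵢⱼ` is annihilated by one of the two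
summands. -/
theorem Sat.mul_pow_four [NeZero N] {R : Type*} [Ring R] {y : Fin 2 → Fin 2 → R}
    (h : Sat N L ν lam y) (i j : Fin 2) : y i j * y i j ^ (4 * N) = y i j := by
  obtain ⟨n, hn⟩ : ∃ n, 4 * N = n + 1 := ⟨4 * N - 1, by have := NeZero.pos N; omega⟩
  have key : y i j * y 0 (j - i) ^ (4 * N) = y i j := by
    have h0 : y i j * y 0 (j - i + 1) ^ (4 * N) = 0 := by
      rw [hn, pow_succ', ← mul_assoc, h.mul_zero _ _ _ _ (by revert i j; decide),
        MulZeroClass.zero_mul]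
    have hs : y 0 (j - i) ^ (4 * N) + y 0 (j - i + 1) ^ (4 * N) = 1 := by
      have := h.sum_pow_four
      rcases (by decide : ∀ a : Fin 2, a = 0 ∨ a = 1) (j - i) with e | e <;> rw [e]
      · exact this
      · exact (add_comm _ _).trans this
    calc y i j * y 0 (j - i) ^ (4 * N)
        = y i j * (y 0 (j - i) ^ (4 * N) + y 0 (j - i + 1) ^ (4 * N)) := by
          rw [mul_add, h0, add_zero]
      _ = y i j := by rw [hs, mul_one]
  have e : y i j ^ (4 * N) = y 0 (j - i) ^ (4 * N) := by
    rw [show 4 * N = 2 * (2 * N) by ring]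
    rcases (by decide : ∀ a : Fin 2, a = 0 ∨ a = 1) i with rfl | rfl
    · rw [sub_zero]
    · rw [h.pow_even 1 j]
      exact congrArg (fun a => y 0 a ^ _) ((by decide : ∀ a : Fin 2, a + 1 = a - 1) j)
  rw [e, key]

theorem Sat.pow_four_mul_add_one [NeZero N] {R : Type*} [Ring R] {y : Fin 2 → Fin 2 → R}
    (h : Sat N L ν lam y) (i j : Fin 2) (n : ℕ) : y i j ^ (4 * N * n + 1) = y i j := by
  induction n with
  | zero => simp
  | succ n ih =>
    rw [show 4 * N * (n + 1) + 1 = 4 * N * n + 1 + 4 * N by ring, pow_add, ih, h.mul_pow_four]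

variable [NeZero N] [NeZero L]

theorem isComatrix_x : IsComatrix k (x : Fin 2 → Fin 2 → SuzukiAlg k N L ν lam) :=
  ⟨comul_x, counit_x⟩

/-- The algebra is spanned by the entries of the Kronecker powers of the comatrix `(xᵢⱼ)`. The
property `Q` allows further facts to be proved for these comatrices by induction. -/
theorem span_comatrix_eq_top
    (Q : ∀ {ι : Type} [Fintype ι] [DecidableEq ι], (ι → ι → SuzukiAlg k N L ν lam) → Prop)
    (hone : Q (fun _ _ : Fin 1 => 1)) (hx : Q x)
    (hmul : ∀ {ι κ : Type} [Fintype ι] [DecidableEq ι] [Fintype κ] [DecidableEq κ]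
      (T : ι → ι → SuzukiAlg k N L ν lam) (U : κ → κ → SuzukiAlg k N L ν lam),
      Q T → Q U → Q (fun p q : ι × κ => T p.1 q.1 * U p.2 q.2)) :
    Submodule.span k {c : SuzukiAlg k N L ν lam | ∃ (ι : Type) (_ : Fintype ι) (_ : DecidableEq ι)
      (T : ι → ι → SuzukiAlg k N L ν lam), (IsComatrix k T ∧ Q T) ∧ ∃ i j, T i j = c} = ⊤ := by
  refine Submodule.eq_top_iff'.mpr fun a => ?_
  induction a using induction with
  | hs r =>
    rw [Algebra.algebraMap_eq_smul_one]
    exact Submodule.smul_mem _ _ (Submodule.subset_span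
      ⟨Fin 1, inferInstance, inferInstance, fun _ _ => 1, ⟨IsComatrix.one, hone⟩, 0, 0, rfl⟩)
  | hx i j =>
    exact Submodule.subset_span
      ⟨Fin 2, inferInstance, inferInstance, x, ⟨isComatrix_x, hx⟩, i, j, rfl⟩
  | hadd a b ha hb => exact Submodule.add_mem _ ha hb
  | hmul a b ha hb =>
    have := Submodule.mul_mem_mul ha hb
    rw [Submodule.span_mul_span] at this
    refine Submodule.span_mono ?_ this
    rintro _ ⟨_, ⟨ι, _, _, T, ⟨hT, hT'⟩, i, j, rfl⟩, _, ⟨κ, _, _, U, ⟨hU, hU'⟩, a, b, rfl⟩, rfl⟩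
    exact ⟨ι × κ, inferInstance, inferInstance, _, ⟨hT.mul hU, hmul T U hT' hU'⟩, (i, a), (j, b),
      rfl⟩

instance : SpannedByComatrices k (SuzukiAlg k N L ν lam) where
  span_eq_top := by
    simpa using span_comatrix_eq_top (k := k) (N := N) (L := L) (ν := ν) (lam := lam)
      (fun _ => True) trivial trivial (fun _ _ _ _ => trivial)

theorem antipode_x (i j : Fin 2) :
    antipode k (x i j : SuzukiAlg k N L ν lam) = x j i ^ (4 * N - 1) :=
  antipodeLin_x i j

theorem antipode_pow (a : SuzukiAlg k N L ν lam) (n : ℕ) :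
    antipode k (a ^ n) = antipode k a ^ n := by
  induction n with
  | zero => simp
  | succ n ih => rw [pow_succ, antipode_mul_antidistrib, ih, pow_succ']

theorem antipode_antipode (a : SuzukiAlg k N L ν lam) : antipode k (antipode k a) = a := by
  induction a using induction with
  | hs r => simp [Algebra.algebraMap_eq_smul_one]
  | hx i j =>
    -- Both applications of `S` raise to the power `4N - 1`, and `(4N - 1)² ≡ 1` modulo `4N`.
    have hN := NeZero.pos N
    have e : (4 * N - 1) * (4 * N - 1) = 4 * N * (4 * N - 2) + 1 := by
      obtain ⟨n, hn⟩ : ∃ n, 4 * N = n + 2 := ⟨4 * N - 2, by omega⟩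
      rw [hn, show n + 2 - 1 = n + 1 from rfl, Nat.add_sub_cancel]
      ring
    rw [antipode_x, antipode_pow, antipode_x, ← pow_mul, e, sat_x.pow_four_mul_add_one]
  | hmul a b ha hb => rw [antipode_mul_antidistrib, antipode_mul_antidistrib, ha, hb]
  | hadd a b ha hb => rw [map_add, map_add, ha, hb]

end SuzukiAlg

/-! ### Multiplicative families of functionals -/

namespace SuzukiAlg

open WithConv Coalgebra HopfAlgebra

variable {k : Type*} [Field k] {N L : ℕ} {ν lam : ℤˣ}

/-- A matrix `p` of linear functionals is multiplicative if `a ↦ (p_{ij}(a))` is a unital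
anti-homomorphism to matrices. This is how `σ(T_{ij}, -)` behaves for a comatrix `T`. -/
structure IsMultiplicative {ι : Type*} [Fintype ι] [DecidableEq ι]
    (p : ι → ι → WithConv (SuzukiAlg k N L ν lam →ₗ[k] k)) : Prop where
  one : ∀ i j, p i j 1 = if i = j then 1 else 0
  mul : ∀ i j a b, p i j (a * b) = ∑ m, p m j a * p i m b

namespace IsMultiplicative

variable {ι κ : Type*} [Fintype ι] [DecidableEq ι] [Fintype κ] [DecidableEq κ]
  {p : ι → ι → WithConv (SuzukiAlg k N L ν lam →ₗ[k] k)}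
  {q : κ → κ → WithConv (SuzukiAlg k N L ν lam →ₗ[k] k)}

theorem comp_mul (hp : IsMultiplicative p) (i j : ι) :
    toConv ((p i j).ofConv ∘ₗ LinearMap.mul' k _) =
      ∑ m, toConv (tensorFunctional (p m j).ofConv (p i m).ofConv) := by
  apply WithConv.ext
  ext a b
  simp [hp.mul, LinearMap.sum_apply]

theorem shift {p : Fin 2 → Fin 2 → WithConv (SuzukiAlg k N L ν lam →ₗ[k] k)}
    (hp : IsMultiplicative p) : IsMultiplicative (fun i j => p (i + 1) (j + 1)) where
  one i j := by rw [hp.one]; simp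
  mul i j a b := by
    rw [hp.mul, Fin.sum_univ_two, Fin.sum_univ_two, add_comm]
    rfl

variable [NeZero N] [NeZero L]

/-- The coefficients of a convolution product of multiplicative functionals multiply like those of
a Kronecker product of matrices, because `A ⊗ A → A` is a homomorphism of coalgebras. -/
theorem conv_mul_apply (hp : IsMultiplicative p) (hq : IsMultiplicative q) (i j : ι) (l m : κ)
    (a b : SuzukiAlg k N L ν lam) : (p i j * q l m) (a * b) =
      ∑ r, ∑ s, (p r j * q s m) a * (p i r * q l s) b := by
  have h := conv_comp_mul (p i j) (q l m)
  rw [hp.comp_mul, hq.comp_mul, Finset.sum_mul_sum] at h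
  simp only [← tensorFunctional_conv_mul] at h
  have := congrArg (fun f => f.ofConv (a ⊗ₜ b)) h
  simpa [LinearMap.sum_apply] using this

theorem conv_mul_one (hp : IsMultiplicative p) (hq : IsMultiplicative q) (i j : ι) (l m : κ) :
    (p i j * q l m) 1 = (if i = j then 1 else 0) * if l = m then 1 else 0 := by
  rw [IsComatrix.one.conv_apply (p i j) (q l m) 0 0]
  simp [hp.one, hq.one]

theorem kronecker (hp : IsMultiplicative p) (hq : IsMultiplicative q) :
    IsMultiplicative (fun s t : ι × κ => p s.1 t.1 * q s.2 t.2) where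
  one s t := by
    rw [hp.conv_mul_one hq]
    simp only [Prod.ext_iff]
    split_ifs <;> simp_all
  mul s t a b := by
    rw [hp.conv_mul_apply hq, Fintype.sum_prod_type]

end IsMultiplicative

variable [NeZero N] [NeZero L]

theorem isMultiplicative_one : IsMultiplicative
    (fun _ _ : Fin 1 => (1 : WithConv (SuzukiAlg k N L ν lam →ₗ[k] k))) where
  one i j := by simp [Subsingleton.elim i j]
  mul i j a b := by simp

/-- The evaluation of linear functionals at the generators, a homomorphism from the convolution
algebra to the matrix algebra. -/
def ev : WithConv (SuzukiAlg k N L ν lam →ₗ[k] k) →+* Matrix (Fin 2) (Fin 2) k where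
  toFun f := .of fun a b => f (x a b)
  map_one' := by
    ext a b
    simp [counit_x, Matrix.one_apply]
  map_mul' f g := by
    ext a b
    rw [Matrix.mul_apply]
    exact isComatrix_x.conv_apply f g a b
  map_zero' := rfl
  map_add' _ _ := rfl

theorem ev_apply (f : WithConv (SuzukiAlg k N L ν lam →ₗ[k] k)) (a b : Fin 2) :
    ev f a b = f (x a b) := rfl

namespace IsMultiplicative

/-- A multiplicative family is determined by its values at the generators. -/
theorem ext {ι : Type*} [Fintype ι] [DecidableEq ι]
    {p q : ι → ι → WithConv (SuzukiAlg k N L ν lam →ₗ[k] k)}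
    (hp : IsMultiplicative p) (hq : IsMultiplicative q)
    (h : ∀ i j, ev (p i j) = ev (q i j)) (i j : ι) : p i j = q i j := by
  apply WithConv.ext
  ext a
  induction a using induction generalizing i j with
  | hs r => rw [Algebra.algebraMap_eq_smul_one, map_smul, map_smul, hp.one, hq.one]
  | hx a b => exact congrFun (congrFun (h i j) a) b
  | hmul a b ha hb => rw [hp.mul, hq.mul]; simp only [ha, hb]
  | hadd a b ha hb => rw [map_add, map_add, ha, hb]

variable {p q : Fin 2 → Fin 2 → WithConv (SuzukiAlg k N L ν lam →ₗ[k] k)}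

/-- The products that vanish at the generators vanish everywhere: each term of the value at `a b`
contains a further product of the same kind as a factor. -/
theorem conv_mul_eq_zero (hp : IsMultiplicative p) (hq : IsMultiplicative q)
    (h : ∀ i j l m, i - j ≠ l - m → ev (p i j) * ev (q l m) = 0) (i j l m : Fin 2)
    (hne : i - j ≠ l - m) : p i j * q l m = 0 := by
  apply WithConv.ext
  ext a
  change (p i j * q l m) a = 0
  induction a using induction generalizing i j l m with
  | hs r =>
    rw [Algebra.algebraMap_eq_smul_one, map_smul, hp.conv_mul_one hq]
    have : ¬ (i = j ∧ l = m) := by rintro ⟨rfl, rfl⟩; simp at hne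
    split_ifs <;> simp_all
  | hx a b =>
    have := h i j l m hne
    rw [← map_mul] at this
    exact congrFun (congrFun this a) b
  | hmul a b ha hb =>
    rw [hp.conv_mul_apply hq]
    refine Finset.sum_eq_zero fun r _ => Finset.sum_eq_zero fun s _ => ?_
    by_cases hrs : r - j = s - m
    · rw [hb i r l s (by clear ha hb; revert i j l m r s; decide), MulZeroClass.mul_zero]
    · rw [ha r j s m hrs, MulZeroClass.zero_mul]
  | hadd a b ha hb => rw [map_add, ha i j l m hne, hb i j l m hne, add_zero]

/-- The sub-matrix of a Kronecker product that is cut out by the vanishing of the mixed products. -/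
theorem mul_shift (hp : IsMultiplicative p) (hq : IsMultiplicative q)
    (h : ∀ i j l m, i - j ≠ l - m → p i j * q l m = 0) (c : Fin 2) :
    IsMultiplicative (fun i j => p i j * q (i + c) (j + c)) where
  one i j := by
    rw [hp.conv_mul_one hq]
    simp
  mul i j a b := by
    rw [hp.conv_mul_apply hq]
    refine Finset.sum_congr rfl fun r _ => ?_
    refine Finset.sum_eq_single (r + c) (fun s _ hs => ?_) (by simp)
    rw [h r j s (j + c) (by revert i j r s c; decide)]
    simp

theorem pow (hp : IsMultiplicative p) (h : ∀ i j l m, i - j ≠ l - m → p i j * p l m = 0) (n : ℕ) :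
    IsMultiplicative (fun i j => p i j ^ (n + 1)) := by
  induction n with
  | zero => simpa using hp
  | succ n ih =>
    have := ih.mul_shift hp (fun i j l m hne => by
      rw [pow_succ, mul_assoc, h i j l m hne, MulZeroClass.mul_zero]) 0
    simpa [pow_succ] using this

theorem chi (hp : IsMultiplicative p) (h : ∀ i j l m, i - j ≠ l - m → p i j * p l m = 0) (n : ℕ) :
    IsMultiplicative (fun i j => chi p i j (n + 1)) := by
  induction n with
  | zero => simpa [_root_.chi] using hp
  | succ n ih =>
    exact hp.mul_shift ih (fun i j l m hne => by
      rw [_root_.chi, ← mul_assoc, h i j l m hne, MulZeroClass.zero_mul]) 1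

/-- A multiplicative family satisfies the defining relations if its values at the generators do:
both sides of a relation are entries of multiplicative families, which agree everywhere
if they agree at the generators. -/
theorem sat (hp : IsMultiplicative p) (h : Sat N L ν lam (fun i j => ev (p i j))) :
    Sat N L ν lam p := by
  have h0 := hp.conv_mul_eq_zero hp h.mul_zero
  have hsq : ∀ i j, p i j ^ 2 = p (i + 1) (j + 1) ^ 2 := by
    refine (hp.pow h0 1).ext (hp.pow h0 1).shift fun i j => ?_
    simpa using h.sq i j
  have hev : ∀ i j m, ev (_root_.chi p i j m) = _root_.chi (fun i j => ev (p i j)) i j m :=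
    map_chi (ev (k := k) (N := N) (L := L) (ν := ν) (lam := lam)).toMonoidHom p
  have hchi : ∀ i j, _root_.chi p i j L = (if i = j then 1 else ((lam : ℤ) : k)) •
      _root_.chi p (i + 1) (j + 1) L := by
    obtain ⟨n, hn⟩ := Nat.exists_eq_succ_of_ne_zero (NeZero.ne L)
    have hc := hp.chi h0 n
    rw [Nat.succ_eq_add_one] at hn
    rw [← hn] at hc
    -- The right-hand side is multiplicative since `λ² = 1` and the parity of `i - j` is additive.
    refine hc.ext ⟨fun i j => ?_, fun i j a b => ?_⟩ fun i j => ?_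
    · have := hc.shift.one i j
      simp only [ofConv_smul, LinearMap.smul_apply, this]
      split_ifs <;> simp
    · have := hc.shift.mul i j a b
      simp only [ofConv_smul, LinearMap.smul_apply, this, Finset.smul_sum]
      refine Finset.sum_congr rfl fun m _ => ?_
      simp only [smul_eq_mul]
      have hu := intCast_unit_mul_self (R := k) lam
      by_cases him : i = m <;> by_cases hmj : m = j
      · simp [him, hmj]
      · simp [him, hmj, mul_assoc]
      · simp [hmj, mul_left_comm]
      · have hij : i = j := by clear this; revert i j m; decide
        rw [if_pos hij, if_neg him, if_neg hmj]
        linear_combination (norm := ring_nf) -(_root_.chi p (m + 1) (j + 1) L a *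
          _root_.chi p (i + 1) (m + 1) L b) * hu
    · have e : ∀ (c : k) (f : WithConv (SuzukiAlg k N L ν lam →ₗ[k] k)), ev (c • f) = c • ev f :=
        fun _ _ => rfl
      rw [e, hev, hev]
      have hl := h.chi_off
      rw [intCast_unit_mul k] at hl
      rcases (by decide : ∀ a : Fin 2, a = 0 ∨ a = 1) i with rfl | rfl <;>
        rcases (by decide : ∀ a : Fin 2, a = 0 ∨ a = 1) j with rfl | rfl
      · simpa using h.chi_diag
      · simp [hl, smul_smul, intCast_unit_mul_self]
      · simpa using hl
      · simpa using h.chi_diag.symm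
  refine ⟨hsq, h0, ?_, ?_, ?_⟩
  · have hpow : ∀ i j, p i j ^ (2 * N) = p (i + 1) (j + 1) ^ (2 * N) := fun i j => by
      rw [pow_mul, pow_mul, hsq]
    obtain ⟨n, hn⟩ : ∃ n, 2 * N = n + 1 := ⟨2 * N - 1, by have := NeZero.pos N; omega⟩
    have hP := hp.pow h0 n
    rw [← hn] at hP
    have h10 : p 1 0 ^ (2 * N) = p 0 1 ^ (2 * N) := hpow 1 0
    have h11 : p 1 1 ^ (2 * N) = p 0 0 ^ (2 * N) := hpow 1 1
    have hν := intCast_unit_mul k ν (p 0 1 ^ (2 * N))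
    have hf : IsMultiplicative (fun _ _ : Fin 1 =>
        p 0 0 ^ (2 * N) + ((ν : ℤ) : WithConv (SuzukiAlg k N L ν lam →ₗ[k] k)) *
          p 0 1 ^ (2 * N)) := by
      refine ⟨fun i j => ?_, fun i j a b => ?_⟩
      · have e1 := hP.one 0 0
        have e2 := hP.one 0 1
        simp only [hν, ofConv_add, ofConv_smul, LinearMap.add_apply,
          LinearMap.smul_apply, e1, e2]
        simp [Subsingleton.elim i j]
      · have e1 := hP.mul 0 0 a b
        have e2 := hP.mul 0 1 a b
        simp only [Fin.sum_univ_two, h10, h11] at e1 e2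
        simp only [hν, ofConv_add, ofConv_smul, LinearMap.add_apply,
          LinearMap.smul_apply, e1, e2, smul_eq_mul, Finset.univ_unique, Finset.sum_singleton]
        linear_combination (norm := ring_nf) -((p 0 1 ^ (2 * N)) a * (p 0 1 ^ (2 * N)) b) *
          intCast_unit_mul_self (R := k) ν
    refine hf.ext isMultiplicative_one (fun i j => ?_) 0 0
    rw [map_add, map_mul, map_intCast, map_pow, map_pow, map_one]
    exact h.pow
  · simpa using hchi 0 0
  · rw [intCast_unit_mul k]
    simpa using hchi 1 0

end IsMultiplicative

end SuzukiAlg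

/-! ### Existence and uniqueness of braidings with given values at the generators -/

section Commutation

open WithConv Coalgebra

variable {k A ι : Type*} [Field k] [Ring A] [Bialgebra k A] [Fintype ι] [DecidableEq ι]
  {T : ι → ι → A}

/-- The left action `x ↦ ∑ f(x₍₁₎) x₍₂₎` of a linear functional. -/
noncomputable def actLeft (f : A →ₗ[k] k) : A →ₗ[k] A :=
  (toConv (asScalar A f) * toConv (LinearMap.id : A →ₗ[k] A)).ofConv

/-- The right action `x ↦ ∑ f(x₍₂₎) x₍₁₎` of a linear functional. -/
noncomputable def actRight (f : A →ₗ[k] k) : A →ₗ[k] A :=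
  (toConv (LinearMap.id : A →ₗ[k] A) * toConv (asScalar A f)).ofConv

theorem actLeft_apply (hT : IsComatrix k T) (f : A →ₗ[k] k) (i j : ι) :
    actLeft f (T i j) = ∑ m, f (T i m) • T m j :=
  hT.asScalar_conv_apply f LinearMap.id i j

theorem actRight_apply (hT : IsComatrix k T) (f : A →ₗ[k] k) (i j : ι) :
    actRight f (T i j) = ∑ m, f (T m j) • T i m :=
  hT.conv_asScalar_apply f LinearMap.id i j

theorem actLeft_one (f : A →ₗ[k] k) : actLeft f 1 = f 1 • 1 := by
  simpa using actLeft_apply IsComatrix.one f 0 0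

theorem actRight_one (f : A →ₗ[k] k) : actRight f 1 = f 1 • 1 := by
  simpa using actRight_apply IsComatrix.one f 0 0

variable [SpannedByComatrices k A]

theorem actLeft_mul {α : Type*} [Fintype α] {f : A →ₗ[k] k} {g h : α → A →ₗ[k] k}
    (hf : ∀ x y, f (x * y) = ∑ r, g r x * h r y) (x y : A) :
    actLeft f (x * y) = ∑ r, actLeft (g r) x * actLeft (h r) y := by
  have : actLeft f ∘ₗ LinearMap.mul' k A = ∑ r, LinearMap.mul' k A ∘ₗ
      TensorProduct.map (actLeft (g r)) (actLeft (h r)) := by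
    refine SpannedByComatrices.hom_ext_tmul fun ι κ _ _ _ _ T U hT hU i j a b => ?_
    have := actLeft_apply (hT.mul hU) f (i, a) (j, b)
    simp only [LinearMap.comp_apply, LinearMap.mul'_apply, LinearMap.sum_apply,
      TensorProduct.map_tmul, actLeft_apply hT, actLeft_apply hU, this, hf, Finset.sum_mul_sum,
      Finset.sum_smul, Fintype.sum_prod_type, smul_mul_smul_comm]
    rw [sum_rotate_three]
  simpa [LinearMap.sum_apply] using LinearMap.congr_fun this (x ⊗ₜ y)

theorem actRight_mul {α : Type*} [Fintype α] {f : A →ₗ[k] k} {g h : α → A →ₗ[k] k}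
    (hf : ∀ x y, f (x * y) = ∑ r, g r x * h r y) (x y : A) :
    actRight f (x * y) = ∑ r, actRight (g r) x * actRight (h r) y := by
  have : actRight f ∘ₗ LinearMap.mul' k A = ∑ r, LinearMap.mul' k A ∘ₗ
      TensorProduct.map (actRight (g r)) (actRight (h r)) := by
    refine SpannedByComatrices.hom_ext_tmul fun ι κ _ _ _ _ T U hT hU i j a b => ?_
    have := actRight_apply (hT.mul hU) f (i, a) (j, b)
    simp only [LinearMap.comp_apply, LinearMap.mul'_apply, LinearMap.sum_apply,
      TensorProduct.map_tmul, actRight_apply hT, actRight_apply hU, this, hf, Finset.sum_mul_sum,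
      Finset.sum_smul, Fintype.sum_prod_type, smul_mul_smul_comm]
    rw [sum_rotate_three]
  simpa [LinearMap.sum_apply] using LinearMap.congr_fun this (x ⊗ₜ y)

/-- The elements `x` for which the commutation rule of `σ` holds with the entries of a comatrix `U`
in the second argument are closed under products: with `F = σ(-, U)`, the rule says that the
algebra maps `x ↦ F(x₍₁₎) x₍₂₎` and `x ↦ x₍₁₎ F(x₍₂₎)` to matrices are intertwined by `U`. -/
theorem comm_left_mul {κ : Type*} [Fintype κ] {U : κ → κ → A} {F : κ → κ → A →ₗ[k] k}
    (hF : ∀ a b x y, F a b (x * y) = ∑ n, F a n x * F n b y) {x y : A}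
    (hx : ∀ a b, ∑ n, actLeft (F a n) x * U n b = ∑ n, U a n * actRight (F n b) x)
    (hy : ∀ a b, ∑ n, actLeft (F a n) y * U n b = ∑ n, U a n * actRight (F n b) y) (a b : κ) :
    ∑ n, actLeft (F a n) (x * y) * U n b = ∑ n, U a n * actRight (F n b) (x * y) := by
  calc ∑ n, actLeft (F a n) (x * y) * U n b
      = ∑ r, actLeft (F a r) x * ∑ n, actLeft (F r n) y * U n b := by
        simp only [actLeft_mul (hF a _), Finset.sum_mul, Finset.mul_sum, mul_assoc]
        exact Finset.sum_comm
    _ = ∑ n, (∑ r, actLeft (F a r) x * U r n) * actRight (F n b) y := by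
        simp only [hy, Finset.sum_mul, Finset.mul_sum, mul_assoc]
        exact Finset.sum_comm
    _ = _ := by
        simp only [hx, actRight_mul (hF _ b), Finset.sum_mul, Finset.mul_sum, mul_assoc]
        exact Finset.sum_comm

/-- The analogue of `comm_left_mul` in the second argument of `σ`, with `G = σ(T, -)`. -/
theorem comm_right_mul {κ : Type*} [Fintype κ] {T : κ → κ → A} {G : κ → κ → A →ₗ[k] k}
    (hG : ∀ i j x y, G i j (x * y) = ∑ m, G m j x * G i m y) {x y : A}
    (hx : ∀ i j, ∑ m, T m j * actLeft (G i m) x = ∑ m, actRight (G m j) x * T i m)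
    (hy : ∀ i j, ∑ m, T m j * actLeft (G i m) y = ∑ m, actRight (G m j) y * T i m) (i j : κ) :
    ∑ m, T m j * actLeft (G i m) (x * y) = ∑ m, actRight (G m j) (x * y) * T i m := by
  calc ∑ m, T m j * actLeft (G i m) (x * y)
      = ∑ r, (∑ m, T m j * actLeft (G r m) x) * actLeft (G i r) y := by
        simp only [actLeft_mul (hG i _), Finset.sum_mul, Finset.mul_sum, mul_assoc]
        exact Finset.sum_comm
    _ = ∑ m, actRight (G m j) x * ∑ r, T r m * actLeft (G i r) y := by
        simp only [hx, Finset.sum_mul, Finset.mul_sum, mul_assoc]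
        exact Finset.sum_comm
    _ = _ := by
        simp only [hy, actRight_mul (hG _ j), Finset.sum_mul, Finset.mul_sum, mul_assoc]
        exact Finset.sum_comm

end Commutation

namespace SuzukiAlg

open WithConv Coalgebra HopfAlgebra

variable {k : Type*} [Field k] {N L : ℕ} {ν lam : ℤˣ}

/-- The transposed entries of a representation, as linear functionals. -/
noncomputable def entry (ρ : SuzukiAlg k N L ν lam →ₐ[k] Matrix (Fin 2) (Fin 2) k) (i j : Fin 2) :
    WithConv (SuzukiAlg k N L ν lam →ₗ[k] k) :=
  toConv (Matrix.entryLinearMap k k j i ∘ₗ ρ.toLinearMap)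

theorem isMultiplicative_entry
    (ρ : SuzukiAlg k N L ν lam →ₐ[k] Matrix (Fin 2) (Fin 2) k) :
    IsMultiplicative (entry ρ) where
  one i j := by simp [entry, Matrix.one_apply, eq_comm]
  mul i j a b := by simp [entry, Matrix.mul_apply]

variable [NeZero N] [NeZero L]

theorem braiding_ext {σ τ : SuzukiAlg k N L ν lam ⊗[k] SuzukiAlg k N L ν lam →ₗ[k] k}
    (hσ : IsBraiding σ) (hτ : IsBraiding τ)
    (h : ∀ i j l m, σ (x i j ⊗ₜ x l m) = τ (x i j ⊗ₜ x l m)) : σ = τ := by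
  have h' : ∀ z i j, σ (x i j ⊗ₜ z) = τ (x i j ⊗ₜ z) := by
    intro z
    induction z using induction with
    | hs r =>
      intro i j
      rw [Algebra.algebraMap_eq_smul_one, TensorProduct.tmul_smul, map_smul, map_smul,
        hσ.one_right, hτ.one_right]
    | hx l m => exact fun i j => h i j l m
    | hmul a b ha hb =>
      intro i j
      rw [hσ.mul_right_apply isComatrix_x, hτ.mul_right_apply isComatrix_x]
      simp only [ha, hb]
    | hadd a b ha hb =>
      intro i j
      rw [TensorProduct.tmul_add, map_add, map_add, ha, hb]
  have h'' : ∀ a, TensorProduct.curry σ a = TensorProduct.curry τ a := by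
    intro a
    induction a using induction with
    | hs r =>
      ext z
      rw [Algebra.algebraMap_eq_smul_one, map_smul, map_smul]
      simp [hσ.one_left, hτ.one_left]
    | hx i j => exact LinearMap.ext fun z => h' z i j
    | hmul a b ha hb =>
      ext z
      simp only [TensorProduct.curry_apply]
      rw [hσ.mul_left, hτ.mul_left, ha, hb]
    | hadd a b ha hb => rw [map_add, map_add, ha, hb]
  exact TensorProduct.ext (LinearMap.ext h'')

/-- The pairing given by an algebra map from `A` to its convolution dual. -/
noncomputable def pairing
    (Φ : SuzukiAlg k N L ν lam →ₐ[k] WithConv (SuzukiAlg k N L ν lam →ₗ[k] k)) :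
    SuzukiAlg k N L ν lam ⊗[k] SuzukiAlg k N L ν lam →ₗ[k] k :=
  TensorProduct.lift ((WithConv.linearEquiv k _).toLinearMap ∘ₗ Φ.toLinearMap)

@[simp] theorem pairing_tmul
    (Φ : SuzukiAlg k N L ν lam →ₐ[k] WithConv (SuzukiAlg k N L ν lam →ₗ[k] k))
    (a b : SuzukiAlg k N L ν lam) : pairing Φ (a ⊗ₜ b) = Φ a b := rfl

section pairing

variable {Φ : SuzukiAlg k N L ν lam →ₐ[k] WithConv (SuzukiAlg k N L ν lam →ₗ[k] k)}

theorem pairing_mul_left (a b c : SuzukiAlg k N L ν lam) : pairing Φ ((a * b) ⊗ₜ c) =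
    (toConv (TensorProduct.curry (pairing Φ) a) *
      toConv (TensorProduct.curry (pairing Φ) b)) c := by
  rw [pairing_tmul, map_mul]
  rfl

theorem pairing_mul_left_apply {ι : Type*} [Fintype ι] [DecidableEq ι]
    {T : ι → ι → SuzukiAlg k N L ν lam} (hT : IsComatrix k T) (a b : SuzukiAlg k N L ν lam)
    (i j : ι) : pairing Φ ((a * b) ⊗ₜ T i j) =
      ∑ m, pairing Φ (a ⊗ₜ T i m) * pairing Φ (b ⊗ₜ T m j) := by
  simp only [pairing_tmul]
  rw [map_mul, hT.conv_apply]

/-- The convolution inverse is `(a, b) ↦ Φ(S(a))(b)`. -/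
theorem isUnit_pairing : IsUnit (toConv (pairing Φ)) := by
  refine ⟨⟨_, toConv (pairing Φ ∘ₗ (antipode k).rTensor _), ?_, ?_⟩, rfl⟩
  all_goals
    apply WithConv.ext
    refine SpannedByComatrices.hom_ext_tmul fun ι κ _ _ _ _ T U hT hU i j a b => ?_
    rw [hT.conv_tmul_apply hU, hT.one_tmul_apply hU]
    simp only [LinearMap.comp_apply, LinearMap.rTensor_tmul, ← pairing_mul_left_apply hU,
      ← map_sum, ← TensorProduct.sum_tmul, hT.sum_mul_antipode, hT.sum_antipode_mul]
    split_ifs <;> simp [hU.counit, *]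

theorem pairing_one_right (hΦ : IsMultiplicative (fun i j => Φ (x i j)))
    (a : SuzukiAlg k N L ν lam) : pairing Φ (a ⊗ₜ 1) = counit (R := k) a := by
  rw [pairing_tmul]
  induction a using induction with
  | hs r => simp
  | hx i j => rw [hΦ.one, counit_x]
  | hmul a b ha hb =>
    rw [map_mul, IsComatrix.one.conv_apply _ _ 0 0, Bialgebra.counit_mul, ← ha, ← hb]
    simp
  | hadd a b ha hb =>
    rw [map_add, map_add, ← ha, ← hb]
    rfl

theorem pairing_mul_right (hΦ : IsMultiplicative (fun i j => Φ (x i j)))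
    (a b c : SuzukiAlg k N L ν lam) : pairing Φ (a ⊗ₜ (b * c)) =
      (toConv ((TensorProduct.curry (pairing Φ)).flip c) *
        toConv ((TensorProduct.curry (pairing Φ)).flip b)) a := by
  have hspan := span_comatrix_eq_top (k := k) (N := N) (L := L) (ν := ν) (lam := lam)
    (fun T => IsMultiplicative (fun i j => Φ (T i j)))
    (by simpa using isMultiplicative_one) hΦ
    (fun T U hT hU => by simpa using hT.kronecker hU)
  refine LinearMap.congr_fun (f := (TensorProduct.curry (pairing Φ)).flip (b * c)) ?_ a
  refine LinearMap.ext_on hspan ?_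
  rintro _ ⟨ι, _, _, T, ⟨hT, hT'⟩, i, j, rfl⟩
  rw [hT.conv_apply]
  change Φ (T i j) (b * c) = ∑ m, Φ (T i m) c * Φ (T m j) b
  rw [hT'.mul]
  exact Finset.sum_congr rfl fun _ _ => mul_comm _ _

/-- The commutation rule holds everywhere if it holds at the generators. It is extended to products
in the first argument, with the generators in the second one, and then in the second argument, with
the entries of an arbitrary comatrix in the first one. -/
theorem pairing_comm (hΦ : IsMultiplicative (fun i j => Φ (x i j)))
    (h : ∀ i j a b, ∑ m, ∑ n, Φ (x i m) (x a n) •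
        (x m j * x n b : SuzukiAlg k N L ν lam) =
      ∑ m, ∑ n, Φ (x m j) (x n b) • (x a n * x i m)) :
    toConv (asScalar _ (pairing Φ)) * toConv (LinearMap.mul' k _) =
      toConv (LinearMap.mul' k _ ∘ₗ (TensorProduct.comm k (SuzukiAlg k N L ν lam)
        (SuzukiAlg k N L ν lam)).toLinearMap) * toConv (asScalar _ (pairing Φ)) := by
  have hX : IsComatrix k (x : Fin 2 → Fin 2 → SuzukiAlg k N L ν lam) := isComatrix_x
  let F (a b : Fin 2) : SuzukiAlg k N L ν lam →ₗ[k] k :=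
    (TensorProduct.curry (pairing Φ)).flip (x a b)
  have hleft : ∀ (z : SuzukiAlg k N L ν lam) (a b : Fin 2),
      ∑ n, actLeft (F a n) z * x n b = ∑ n, x a n * actRight (F n b) z := by
    intro z
    induction z using induction with
    | hs r =>
      intro a b
      simp only [Algebra.algebraMap_eq_smul_one, map_smul, actLeft_one, actRight_one]
      have : ∀ a b, F a b 1 = if a = b then 1 else 0 := fun a b => by simp [F, counit_x]
      simp [this]
    | hx i j =>
      intro a b
      simp only [actLeft_apply hX, actRight_apply hX, Finset.sum_mul,
        Finset.mul_sum, smul_mul_assoc, mul_smul_comm]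
      rw [Finset.sum_comm]
      exact (h i j a b).trans Finset.sum_comm
    | hmul y z hy hz =>
      exact comm_left_mul (fun a b y z => pairing_mul_left_apply isComatrix_x y z a b) hy hz
    | hadd y z hy hz =>
      intro a b
      simp only [map_add, add_mul, mul_add, Finset.sum_add_distrib, hy, hz]
  apply WithConv.ext
  refine SpannedByComatrices.hom_ext_tmul fun ι κ _ _ _ _ T U hT hU i j a b => ?_
  let G (i j : ι) : SuzukiAlg k N L ν lam →ₗ[k] k := TensorProduct.curry (pairing Φ) (T i j)
  have hG : ∀ i j y z, G i j (y * z) = ∑ m, G m j y * G i m z := fun i j y z => by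
    refine (pairing_mul_right hΦ (T i j) y z).trans ?_
    rw [hT.conv_apply]
    exact Finset.sum_congr rfl fun _ _ => mul_comm _ _
  have hright : ∀ (z : SuzukiAlg k N L ν lam) (i j : ι),
      ∑ m, T m j * actLeft (G i m) z = ∑ m, actRight (G m j) z * T i m := by
    intro z
    induction z using induction with
    | hs r =>
      intro i j
      simp only [Algebra.algebraMap_eq_smul_one, map_smul, actLeft_one, actRight_one]
      have : ∀ i j, G i j 1 = if i = j then 1 else 0 := fun i j =>
        (pairing_one_right hΦ (T i j)).trans (hT.counit i j)
      simp [this]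
    | hx a b =>
      intro i j
      have := hleft (T i j) a b
      simp only [actLeft_apply hT, actRight_apply hT, Finset.sum_mul,
        Finset.mul_sum, smul_mul_assoc, mul_smul_comm] at this
      simp only [actLeft_apply hX, actRight_apply hX, Finset.sum_mul,
        Finset.mul_sum, smul_mul_assoc, mul_smul_comm]
      rw [Finset.sum_comm]
      refine this.trans ?_
      rw [Finset.sum_comm]
      rfl
    | hmul y z hy hz => exact comm_right_mul hG hy hz
    | hadd y z hy hz =>
      intro a b
      simp only [map_add, add_mul, mul_add, Finset.sum_add_distrib, hy, hz]
  rw [hT.conv_tmul_apply hU, hT.conv_tmul_apply hU]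
  have := hright (U a b) i j
  simp only [actLeft_apply hU, actRight_apply hU, Finset.sum_mul,
        Finset.mul_sum, smul_mul_assoc, mul_smul_comm] at this
  simpa [asScalar, Algebra.smul_def, Algebra.commutes, G] using this

end pairing

/-- A form on the generators extends to a unique braiding if the matrices of its values satisfy the
defining relations in each argument and the commutation rule holds at the generators. -/
theorem existsUnique_braiding (s : Fin 2 → Fin 2 → Fin 2 → Fin 2 → k)
    (h₁ : Sat N L ν lam (fun i j => Matrix.of fun l m => s i j l m))
    (h₂ : Sat N L ν lam (fun l m => Matrix.of fun i j => s j i l m))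
    (hc : ∀ i j a b, ∑ m, ∑ n, s i m a n • (x m j * x n b : SuzukiAlg k N L ν lam) =
      ∑ m, ∑ n, s m j n b • (x a n * x i m)) :
    ∃! σ : SuzukiAlg k N L ν lam ⊗[k] SuzukiAlg k N L ν lam →ₗ[k] k,
      IsBraiding σ ∧ ∀ i j l m, σ (x i j ⊗ₜ x l m) = s i j l m := by
  -- `h₂` turns `s` into a multiplicative family of functionals in the second argument, and `h₁`
  -- shows that this family satisfies the defining relations, hence extends in the first argument.
  have hp := isMultiplicative_entry (lift (k := k) _ h₂)
  have he : ∀ i j, ev (entry (lift (k := k) _ h₂) i j) = Matrix.of fun l m => s i j l m := by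
    intro i j
    ext l m
    simp [ev_apply, entry]
  let Φ : SuzukiAlg k N L ν lam →ₐ[k] WithConv (SuzukiAlg k N L ν lam →ₗ[k] k) :=
    lift (entry (lift (k := k) _ h₂)) (hp.sat (by simpa only [he] using h₁))
  have hΦ : ∀ i j, Φ (x i j) = entry (lift (k := k) _ h₂) i j := fun i j => lift_x _ _ i j
  have hv : ∀ i j l m, pairing Φ (x i j ⊗ₜ x l m) = s i j l m := fun i j l m => by
    rw [pairing_tmul, hΦ]
    exact congrFun (congrFun (he i j) l) m
  have hm : IsMultiplicative (fun i j => Φ (x i j)) := by simpa only [hΦ] using hp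
  have hb : IsBraiding (pairing Φ) := ⟨isUnit_pairing,
    pairing_comm hm (by simpa only [← pairing_tmul, hv] using hc), pairing_mul_left,
    pairing_mul_right hm⟩
  exact ⟨pairing Φ, ⟨hb, hv⟩, fun τ hτ => braiding_ext hτ.1 hb fun i j l m =>
    (hτ.2 i j l m).trans (hv i j l m).symm⟩

end SuzukiAlg

/-! ### Two-dimensional representations -/

namespace SuzukiAlg

section Representations

variable {k : Type*} [Field k] {N L : ℕ} {ν lam : ℤˣ}

/-- The antidiagonal matrix with entries `α` and `β`. -/
abbrev antidiag (α β : k) : Matrix (Fin 2) (Fin 2) k := !![0, α; β, 0]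

theorem antidiag_mul_diagonal (α β γ δ : k) :
    antidiag α β * Matrix.diagonal ![δ, γ] =
      Matrix.diagonal ![α * γ, β * δ] * antidiag 1 1 := by
  ext i j
  fin_cases i <;> fin_cases j <;> simp [Matrix.mul_apply]

theorem antidiag_sq (α β : k) : antidiag α β ^ 2 = (α * β) • (1 : Matrix (Fin 2) (Fin 2) k) := by
  ext i j
  fin_cases i <;> fin_cases j <;> simp [pow_two, Matrix.mul_apply, mul_comm]

/-- The alternating products of antidiagonal matrices, with the swap matrix `antidiag 1 1`
factored out on the right. -/
theorem chi_antidiag {y : Fin 2 → Fin 2 → Matrix (Fin 2) (Fin 2) k} {i j : Fin 2} {α β : k}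
    (h : y i j = antidiag α β) (h' : y (i + 1) (j + 1) = antidiag β α) (m : ℕ) :
    chi y i j m = Matrix.diagonal ![α ^ m, β ^ m] * antidiag 1 1 ^ m := by
  induction m generalizing i j α β with
  | zero =>
    simp only [chi, pow_zero, mul_one]
    ext a b
    fin_cases a <;> fin_cases b <;> simp
  | succ m ih =>
    have e : ∀ a : Fin 2, a + 1 + 1 = a := by decide
    rw [chi, ih h' (by rw [e, e, h]), h, ← mul_assoc, antidiag_mul_diagonal, mul_assoc,
      ← pow_succ', ← pow_succ', ← pow_succ']

theorem chi_zero {R : Type*} [Ring R] [NeZero L] {y : Fin 2 → Fin 2 → R} {i j : Fin 2}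
    (h : y i j = 0) : chi y i j L = 0 := by
  obtain ⟨n, hn⟩ := Nat.exists_eq_succ_of_ne_zero (NeZero.ne L)
  rw [hn, chi, h, MulZeroClass.zero_mul]

/-- The representation in which the diagonal generators vanish. -/
theorem sat_off [NeZero N] [NeZero L] {α β : k} (h : (α * β) ^ N = ((ν : ℤ) : k))
    (h' : α ^ L = ((lam : ℤ) : k) * β ^ L) :
    Sat N L ν lam ![![0, antidiag α β], ![antidiag β α, 0]] := by
  have hN := NeZero.ne N
  have hl : β ^ L = ((lam : ℤ) : k) * α ^ L := by
    rw [h', ← mul_assoc, intCast_unit_mul_self, one_mul]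
  refine ⟨fun i j => ?_, fun i j l m hne => ?_, ?_, ?_, ?_⟩
  · fin_cases i <;> fin_cases j <;> simp [antidiag_sq, mul_comm]
  · fin_cases i <;> fin_cases j <;> fin_cases l <;> fin_cases m <;>
      first | exact absurd (by decide) hne | simp
  · have : (![![0, antidiag α β], ![antidiag β α, 0]] : Fin 2 → Fin 2 → _) 0 1 = antidiag α β := rfl
    rw [this, pow_mul (antidiag α β), antidiag_sq, smul_pow, one_pow, intCast_unit_mul k, h,
      smul_smul, intCast_unit_mul_self]
    simp [hN]
  · rw [chi_zero (i := 0) (j := 0) rfl, chi_zero (i := 1) (j := 1) rfl]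
  · rw [chi_antidiag (i := 1) (j := 0) (α := β) (β := α) rfl rfl,
      chi_antidiag (i := 0) (j := 1) (α := α) (β := β) rfl rfl, intCast_unit_mul k,
      ← Matrix.smul_mul]
    congr 1
    ext a b
    fin_cases a <;> fin_cases b <;> simp [hl, ← mul_assoc, intCast_unit_mul_self]

/-- The representation in which the off-diagonal generators vanish. -/
theorem sat_diag [NeZero N] [NeZero L] {α β : k} (h : (α * β) ^ N = 1) (h' : α ^ L = β ^ L) :
    Sat N L ν lam ![![antidiag α β, 0], ![0, antidiag β α]] := by
  have hN := NeZero.ne N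
  refine ⟨fun i j => ?_, fun i j l m hne => ?_, ?_, ?_, ?_⟩
  · fin_cases i <;> fin_cases j <;> simp [antidiag_sq, mul_comm]
  · fin_cases i <;> fin_cases j <;> fin_cases l <;> fin_cases m <;>
      first | exact absurd (by decide) hne | simp
  · have : (![![antidiag α β, 0], ![0, antidiag β α]] : Fin 2 → Fin 2 → _) 0 0 = antidiag α β := rfl
    rw [this, pow_mul (antidiag α β), antidiag_sq, smul_pow, one_pow, h]
    simp [hN]
  · rw [chi_antidiag (i := 0) (j := 0) (α := α) (β := β) rfl rfl,
      chi_antidiag (i := 1) (j := 1) (α := β) (β := α) rfl rfl, h']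
  · rw [chi_zero (i := 0) (j := 1) rfl, chi_zero (i := 1) (j := 0) rfl, MulZeroClass.mul_zero]

/-- For `L = 2`, the diagonal generators may act by commuting diagonal matrices. -/
theorem sat_diag_two [NeZero N] {a b c d : k} (hac : a ^ 2 = c ^ 2) (hbd : b ^ 2 = d ^ 2)
    (ha : a ^ (2 * N) = 1) (hb : b ^ (2 * N) = 1) :
    Sat N 2 ν lam
      ![![Matrix.diagonal ![a, b], 0], ![0, Matrix.diagonal ![c, d]]] := by
  have hN := NeZero.ne N
  refine ⟨fun i j => ?_, fun i j l m hne => ?_, ?_, ?_, ?_⟩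
  · fin_cases i <;> fin_cases j <;> simp [Matrix.diagonal_pow, hac, hbd]
  · fin_cases i <;> fin_cases j <;> fin_cases l <;> fin_cases m <;>
      first | exact absurd (by decide) hne | simp
  · have hpow : ![a, b] ^ (2 * N) = 1 := by
      ext i
      fin_cases i <;> simp [ha, hb]
    simp [Matrix.diagonal_pow, hpow, hN]
  · simp [chi, mul_comm]
  · simp [chi]

variable [NeZero N] [NeZero L]

/-- The generator `x₁₂` acts by a nonzero antidiagonal matrix in the representation of `sat_off`
for suitable roots `α`, `β`. -/
theorem x_off_ne_zero [IsAlgClosed k] : (x 0 1 : SuzukiAlg k N L ν lam) ≠ 0 := by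
  obtain ⟨t, ht⟩ := IsAlgClosed.exists_pow_nat_eq ((lam : ℤ) : k) (NeZero.pos L)
  obtain ⟨s, hs⟩ := IsAlgClosed.exists_pow_nat_eq ((ν : ℤ) : k) (NeZero.pos N)
  have hu : ∀ u : ℤˣ, ((u : ℤ) : k) ≠ 0 := fun u =>
    left_ne_zero_of_mul_eq_one (intCast_unit_mul_self u)
  have ht0 : t ≠ 0 := by rintro rfl; exact hu lam (by rw [← ht, zero_pow (NeZero.ne L)])
  have hs0 : s ≠ 0 := by rintro rfl; exact hu ν (by rw [← hs, zero_pow (NeZero.ne N)])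
  obtain ⟨β, hβ⟩ := IsAlgClosed.exists_pow_nat_eq (s / t) (n := 2) (by norm_num)
  have hsat : Sat N L ν lam ![![0, antidiag (t * β) β], ![antidiag β (t * β), 0]] := by
    refine sat_off ?_ (by rw [mul_pow, ht])
    rw [mul_assoc, ← pow_two, hβ, mul_div_cancel₀ _ ht0, hs]
  intro h0
  have := lift_x (k := k) _ hsat 0 1
  rw [h0, map_zero] at this
  have hβ0 : β = 0 := by simpa using (congrFun (congrFun this 1) 0).symm
  rw [hβ0, zero_pow two_ne_zero] at hβ
  exact div_ne_zero hs0 ht0 hβ.symm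

/-- A representation that separates `x₁₁` from `x₂₂` and kills the off-diagonal generators. It
exists because there is an `L`-th root of unity other than `1`. -/
theorem exists_diag_ne [IsAlgClosed k] (hL : 2 ≤ L) (hchar : (L : k) ≠ 0) :
    ∃ ρ : SuzukiAlg k N L ν lam →ₐ[k] Matrix (Fin 2) (Fin 2) k,
      ρ (x 0 1) = 0 ∧ ρ (x 1 0) = 0 ∧ ρ (x 0 0) ≠ ρ (x 1 1) := by
  have : NeZero (L : k) := ⟨hchar⟩
  obtain ⟨t, ht⟩ := HasEnoughRootsOfUnity.exists_primitiveRoot k L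
  have ht0 : t ≠ 0 := ht.ne_zero (NeZero.ne L)
  have ht1 : t ≠ 1 := ht.ne_one hL
  obtain ⟨β, hβ⟩ := IsAlgClosed.exists_pow_nat_eq (t⁻¹) (n := 2) (by norm_num)
  have hβ0 : β ≠ 0 := by
    rintro rfl
    rw [zero_pow two_ne_zero] at hβ
    exact inv_ne_zero ht0 hβ.symm
  have hsat : Sat N L ν lam ![![antidiag (t * β) β, 0], ![0, antidiag β (t * β)]] := by
    refine sat_diag ?_ (by rw [mul_pow, ht.pow_eq_one, one_mul])
    rw [mul_assoc, ← pow_two, hβ, mul_inv_cancel₀ ht0, one_pow]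
  refine ⟨lift (k := k) _ hsat, by simp, by simp, fun h => ht1 ?_⟩
  rw [lift_x, lift_x] at h
  have := congrFun (congrFun h 0) 1
  simpa [hβ0] using this

end Representations

end SuzukiAlg

/-! ### Central characters and the classification of coribbon elements -/

namespace SuzukiAlg

open WithConv Coalgebra HopfAlgebra

section Classification

variable {k : Type*} [Field k] {N L : ℕ} {ν lam : ℤˣ} {c ω : k}
  {θ θ' : SuzukiAlg k N L ν lam →ₗ[k] k}
  {η : SuzukiAlg k N L ν lam →ₐ[k] k}
  {σ : SuzukiAlg k N L ν lam ⊗[k] SuzukiAlg k N L ν lam →ₗ[k] k}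

theorem _root_.ExtendsTheta.unique {ω' : k} (h : ExtendsTheta ω θ) (h' : ExtendsTheta ω' θ) :
    ω = ω' := by
  have h1 := h 0 0
  rw [h' 0 0] at h1
  simpa using h1.symm

theorem pow_eq_one_of_character [NeZero N] (h : ExtendsTheta c η.toLinearMap) :
    c ^ (2 * N) = 1 := by
  have h00 : η (x 0 0) = c := h 0 0
  have h01 : η (x 0 1) = 0 := h 0 1
  have := congrArg η (sat_x (k := k) (N := N) (L := L) (ν := ν) (lam := lam)).pow
  simpa [h00, h01, NeZero.ne N] using this

theorem sat_character [NeZero N] [NeZero L] (hc : c ^ (2 * N) = 1) :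
    Sat N L ν lam (fun i j : Fin 2 => if i = j then c else 0) := by
  have hchi : ∀ i j m, chi (fun i j : Fin 2 => if i = j then c else 0) i j (m + 1) =
      if i = j then c ^ (m + 1) else 0 := by
    intro i j m
    induction m generalizing i j with
    | zero => simp [chi]
    | succ m ih => rw [chi, ih]; split_ifs <;> simp_all [pow_succ']
  obtain ⟨L, rfl⟩ := Nat.exists_eq_succ_of_ne_zero (NeZero.ne L)
  refine ⟨fun i j => by simp, fun i j l m hne => ?_, ?_, ?_, ?_⟩
  · split_ifs <;> simp_all
  · simp [hc, NeZero.ne N]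
  · rw [Nat.succ_eq_add_one, hchi, hchi]; simp
  · rw [Nat.succ_eq_add_one, hchi, hchi]; simp

variable [NeZero N] [NeZero L]

theorem exists_character (hc : c ^ (2 * N) = 1) :
    ∃ η : SuzukiAlg k N L ν lam →ₐ[k] k, ExtendsTheta c η.toLinearMap :=
  ⟨lift (k := k) _ (sat_character hc), fun i j => lift_x _ _ i j⟩

theorem isCentralFunctional_character (h : ExtendsTheta c η.toLinearMap) :
    IsCentralFunctional η.toLinearMap := by
  have hX : IsComatrix k (x : Fin 2 → Fin 2 → SuzukiAlg k N L ν lam) := isComatrix_x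
  have hmul : ∀ a b, η.toLinearMap (a * b) = ∑ _r : Fin 1, η.toLinearMap a * η.toLinearMap b := by
    simp
  apply WithConv.ext
  change actLeft _ = actRight _
  ext a
  induction a using induction with
  | hs r =>
    rw [Algebra.algebraMap_eq_smul_one, map_smul, map_smul, actLeft_one, actRight_one]
  | hx i j =>
    rw [actLeft_apply hX, actRight_apply hX]
    have h' : ∀ i j, η.toLinearMap (x i j) = if i = j then c else 0 := h
    simp [h', ite_smul]
  | hmul a b ha hb => rw [actLeft_mul hmul, actRight_mul hmul, ha, hb]
  | hadd a b ha hb => rw [map_add, map_add, ha, hb]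

theorem _root_.ExtendsTheta.mul (h : ExtendsTheta ω θ) (h' : ExtendsTheta c θ') :
    ExtendsTheta (ω * c) (toConv θ * toConv θ').ofConv := by
  intro i j
  rw [isComatrix_x.conv_apply (toConv θ) (toConv θ')]
  simp only [h _ _, h' _ _]
  fin_cases i <;> fin_cases j <;> simp

theorem _root_.ExtendsTheta.comp_antipode (h : ExtendsTheta c η.toLinearMap) :
    ExtendsTheta (c ^ (4 * N - 1)) (η.toLinearMap ∘ₗ antipode k) := by
  intro i j
  have hN := NeZero.pos N
  have h' : η (x j i) = if j = i then c else 0 := h j i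
  rw [LinearMap.comp_apply, antipode_x, AlgHom.toLinearMap_apply, map_pow, h', ite_pow,
    zero_pow (by omega)]
  simp [eq_comm]

theorem _root_.ExtendsTheta.ne_zero (hθ : IsUnit (toConv θ)) (h : ExtendsTheta ω θ) : ω ≠ 0 := by
  obtain ⟨f, hf⟩ := hθ.exists_right_inv
  have := congrArg (fun f => f.ofConv (x 0 0)) hf
  simp only [isComatrix_x.conv_apply (toConv θ) f, h _ _, isComatrix_x.one_apply] at this
  rintro rfl
  simp at this

section Central

variable [IsAlgClosed k]

/-- Central functionals are scalar on the generators. The comparison of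
`θ(x₁₁) x₁₂ + θ(x₁₂) x₂₂ = θ(x₁₂) x₁₁ + θ(x₂₂) x₁₂` in the representation of `exists_diag_ne` gives
`θ(x₁₂) = 0`, and `θ(x₁₁) = θ(x₂₂)` follows from `x₁₂ ≠ 0`. -/
theorem extendsTheta_of_isCentralFunctional (hL : 2 ≤ L) (hchar : (L : k) ≠ 0)
    (h : IsCentralFunctional θ) :
    ExtendsTheta (θ (x 0 0)) θ := by
  obtain ⟨ρ, h01, h10, hne⟩ := exists_diag_ne (k := k) (N := N) (ν := ν) (lam := lam) hL hchar
  have e01 := h.apply isComatrix_x 0 1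
  have e10 := h.apply isComatrix_x 1 0
  rw [Fin.sum_univ_two, Fin.sum_univ_two] at e01 e10
  have t01 : θ (x 0 1) = 0 := by
    have := congrArg ρ e01
    simp only [map_add, map_smul, h01, smul_zero, zero_add, add_zero] at this
    by_contra h0
    exact hne (smul_right_injective _ h0 this).symm
  have t10 : θ (x 1 0) = 0 := by
    have := congrArg ρ e10
    simp only [map_add, map_smul, h10, smul_zero, zero_add, add_zero] at this
    by_contra h0
    exact hne (smul_right_injective _ h0 this)
  have t11 : θ (x 1 1) = θ (x 0 0) := by
    simp only [t01, zero_smul, add_zero, zero_add] at e01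
    exact (smul_left_injective k (x_off_ne_zero (N := N) (L := L) (ν := ν) (lam := lam)) e01).symm
  intro i j
  fin_cases i <;> fin_cases j <;> simp [t01, t10, t11]

/-- A coribbon element is determined by the scalar by which it acts on the generators: the central
character relating two elements with the same scalar is the counit. -/
theorem coribbon_eq (hL : 2 ≤ L) (hchar : (L : k) ≠ 0) (h : IsCoribbon σ θ)
    (h' : IsCoribbon σ θ') (hω : ExtendsTheta ω θ) (hω' : ExtendsTheta ω θ') : θ' = θ := by
  obtain ⟨η, hη, e⟩ := h.exists_algHom h'
  have hη' := extendsTheta_of_isCentralFunctional hL hchar hη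
  have e' : θ' = (toConv θ * toConv η.toLinearMap).ofConv := congrArg ofConv e
  have hc := (hω.mul hη').unique (e' ▸ hω')
  have hc1 : η.toLinearMap (x 0 0) = 1 := mul_left_cancel₀ (hω.ne_zero h.isUnit) (by simpa using hc)
  rw [hc1] at hη'
  have : η = Bialgebra.counitAlgHom k _ := by
    refine algHom_ext fun i j => ?_
    rw [Bialgebra.counitAlgHom_apply, counit_x]
    exact hη' i j
  have h1 : toConv η.toLinearMap = 1 := by
    rw [this]
    rfl
  rw [e', h1, mul_one]

/-- The coribbon elements of a braiding whose Drinfeld functional is `S`-invariant and scalar on the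
generators: they are the products of the Drinfeld functional with the central characters. -/
theorem coribbon_classification (hL : 2 ≤ L) (hchar : (L : k) ≠ 0) (h2 : (2 : k) ≠ 0)
    (hσ : IsBraiding σ) {ω₀ : k}
    (hu : ExtendsTheta ω₀ (drinfeld σ)) (hu' : ExtendsTheta ω₀ (drinfeld σ ∘ₗ antipode k)) :
    (∀ ω : k, (∃ θ, IsCoribbon σ θ ∧ ExtendsTheta ω θ) ↔ ω ^ (2 * N) = ω₀ ^ (2 * N)) ∧
    (∀ θ, IsCoribbon σ θ →
      ∃ ω : k, ExtendsTheta ω θ ∧ ∀ θ', IsCoribbon σ θ' → ExtendsTheta ω θ' → θ' = θ) ∧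
    (∀ ω : k, (∃ θ, IsHopfCoribbon σ θ ∧ ExtendsTheta ω θ) ↔ ω = ω₀ ∨ ω = -ω₀) ∧
    {θ | IsHopfCoribbon σ θ}.ncard = 2 := by
  have hN := NeZero.pos N
  have hcu : IsCoribbon σ (drinfeld σ) := hσ.drinfeld_isCoribbon antipode_antipode
  have h0 : ω₀ ≠ 0 := hu.ne_zero hcu.isUnit
  have huS : drinfeld σ ∘ₗ antipode k = drinfeld σ :=
    coribbon_eq hL hchar hcu (hcu.comp_antipode hσ antipode_antipode) hu hu'
  -- Every coribbon element is the product of the Drinfeld functional and a central character.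
  have hdecomp : ∀ θ, IsCoribbon σ θ → ∃ (c : k) (η : SuzukiAlg k N L ν lam →ₐ[k] k),
      ExtendsTheta c η.toLinearMap ∧ θ = (toConv (drinfeld σ) * toConv η.toLinearMap).ofConv := by
    intro θ hθ
    obtain ⟨η, hη, e⟩ := hcu.exists_algHom hθ
    exact ⟨_, η, extendsTheta_of_isCentralFunctional hL hchar hη, congrArg ofConv e⟩
  -- For a product `u * η`, the composite with `S` is `(η ∘ S) * u`.
  have hcomp : ∀ (c : k) (η : SuzukiAlg k N L ν lam →ₐ[k] k), ExtendsTheta c η.toLinearMap →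
      ExtendsTheta (c ^ (4 * N - 1) * ω₀)
        ((toConv (drinfeld σ) * toConv η.toLinearMap).ofConv ∘ₗ antipode k) := by
    intro c η hη
    have e := conv_comp_antipode (toConv (drinfeld σ)) (toConv η.toLinearMap)
    have e' := congrArg ofConv e
    simp only [huS] at e'
    rw [e']
    exact hη.comp_antipode.mul hu
  have hmk : ∀ (c : k) (η : SuzukiAlg k N L ν lam →ₐ[k] k), ExtendsTheta c η.toLinearMap →
      IsCoribbon σ (toConv (drinfeld σ) * toConv η.toLinearMap).ofConv := fun c η hη =>
    have hc := isCentralFunctional_character hη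
    hcu.mul_algHom η hc (isUnit_algHom hc)
  have h1 : ∀ ω : k, (∃ θ, IsCoribbon σ θ ∧ ExtendsTheta ω θ) ↔ ω ^ (2 * N) = ω₀ ^ (2 * N) := by
    intro ω
    constructor
    · rintro ⟨θ, hθ, hω⟩
      obtain ⟨c, η, hη, rfl⟩ := hdecomp θ hθ
      rw [hω.unique (hu.mul hη), mul_pow, pow_eq_one_of_character hη, mul_one]
    · intro h
      have hc : (ω₀⁻¹ * ω) ^ (2 * N) = 1 := by
        rw [mul_pow, h, inv_pow, inv_mul_cancel₀ (pow_ne_zero _ h0)]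
      obtain ⟨η, hη⟩ := exists_character (L := L) (ν := ν) (lam := lam) hc
      have := hu.mul hη
      rw [mul_inv_cancel_left₀ h0] at this
      exact ⟨_, hmk _ η hη, this⟩
  have h3 : ∀ ω : k, (∃ θ, IsHopfCoribbon σ θ ∧ ExtendsTheta ω θ) ↔ ω = ω₀ ∨ ω = -ω₀ := by
    intro ω
    constructor
    · rintro ⟨θ, hθ, hω⟩
      obtain ⟨c, η, hη, rfl⟩ := hdecomp θ hθ.toIsCoribbon
      have e1 := hω.unique (hu.mul hη)
      have e2 := hcomp c η hη
      rw [hθ.comp_antipode] at e2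
      have e3 := e2.unique hω
      have hc : c ^ (2 * N) = 1 := pow_eq_one_of_character hη
      -- `S`-invariance gives `c⁻¹ = c`, where `c⁻¹` is written as `c ^ (4 * N - 1)`.
      have hc2 : c * c = 1 := by
        have : c ^ (4 * N - 1) = c := mul_right_cancel₀ h0 (by rw [e3, e1, mul_comm])
        calc c * c = c ^ (4 * N - 1) * c := by rw [this]
          _ = (c ^ (2 * N)) ^ 2 := by
            rw [← pow_succ, ← pow_mul]
            congr 1
            omega
          _ = 1 := by rw [hc, one_pow]
      rcases mul_self_eq_one_iff.mp hc2 with rfl | rfl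
      · exact Or.inl (by simpa using e1)
      · exact Or.inr (by simpa using e1)
    · intro h
      obtain ⟨c, hc, rfl⟩ : ∃ c : k, (c = 1 ∨ c = -1) ∧ ω = ω₀ * c := by
        rcases h with rfl | rfl
        · exact ⟨1, Or.inl rfl, by simp⟩
        · exact ⟨-1, Or.inr rfl, by simp⟩
      have hc2 : c ^ 2 = 1 := by rcases hc with rfl | rfl <;> simp
      obtain ⟨η, hη⟩ := exists_character (N := N) (L := L) (ν := ν) (lam := lam) (c := c)
        (by rw [pow_mul, hc2, one_pow])
      have hθ := hmk c η hη
      have hS := hcomp c η hη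
      have hodd : c ^ (4 * N - 1) = c := by
        rw [show 4 * N - 1 = 2 * (2 * N - 1) + 1 by omega, pow_succ, pow_mul, hc2, one_pow,
          one_mul]
      rw [hodd, mul_comm] at hS
      exact ⟨_, ⟨hθ, coribbon_eq hL hchar hθ (hθ.comp_antipode hσ antipode_antipode)
        (hu.mul hη) hS⟩, hu.mul hη⟩
  refine ⟨h1, fun θ hθ => ?_, h3, ?_⟩
  · have hω := extendsTheta_of_isCentralFunctional hL hchar hθ.isCentralFunctional
    exact ⟨_, hω, fun θ' hθ' hω' => coribbon_eq hL hchar hθ hθ' hω hω'⟩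
  · obtain ⟨θ₁, hθ₁, hω₁⟩ := (h3 ω₀).mpr (Or.inl rfl)
    obtain ⟨θ₂, hθ₂, hω₂⟩ := (h3 (-ω₀)).mpr (Or.inr rfl)
    -- The scalars `ω₀` and `-ω₀` differ since `2` is invertible.
    have hne : θ₁ ≠ θ₂ := by
      rintro rfl
      have := hω₁.unique hω₂
      have : 2 * ω₀ = 0 := by linear_combination this
      exact mul_ne_zero h2 h0 this
    have hset : {θ | IsHopfCoribbon σ θ} = {θ₁, θ₂} := by
      ext θ
      constructor
      · intro hθ
        have hθ : IsHopfCoribbon σ θ := hθ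
        have hω := extendsTheta_of_isCentralFunctional hL hchar
          hθ.toIsCoribbon.isCentralFunctional
        rcases (h3 _).mp ⟨θ, hθ, hω⟩ with e | e
        · rw [e] at hω
          exact Or.inl (coribbon_eq hL hchar hθ₁.toIsCoribbon hθ.toIsCoribbon hω₁ hω)
        · rw [e] at hω
          exact Or.inr (coribbon_eq hL hchar hθ₂.toIsCoribbon hθ.toIsCoribbon hω₂ hω)
      · rintro (rfl | rfl)
        · exact hθ₁
        · exact hθ₂
    rw [hset, Set.ncard_pair hne]

end Central

/-- The values of `σ⁻¹` at the generators are read off from an inverse of the matrix of the values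
of `σ`. -/
theorem inverse_apply (hσ : IsBraiding σ) {s : Fin 2 → Fin 2 → Fin 2 → Fin 2 → k}
    (hs : ∀ i j a b, ∑ m, ∑ n, σ (x i m ⊗ₜ x a n) * s m j n b =
      (if i = j then 1 else 0) * (if a = b then 1 else 0)) (i j a b : Fin 2) :
    σ (x i j ⊗ₜ antipode k (x a b)) = s i j a b := by
  let M : Matrix (Fin 2 × Fin 2) (Fin 2 × Fin 2) k :=
    .of fun p q => σ (x p.1 q.1 ⊗ₜ x p.2 q.2)
  let M' : Matrix (Fin 2 × Fin 2) (Fin 2 × Fin 2) k :=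
    .of fun p q => σ (x p.1 q.1 ⊗ₜ antipode k (x p.2 q.2))
  let M'' : Matrix (Fin 2 × Fin 2) (Fin 2 × Fin 2) k := .of fun p q => s p.1 q.1 p.2 q.2
  have hone : ∀ p q : Fin 2 × Fin 2,
      ((if p.1 = q.1 then 1 else 0) * (if p.2 = q.2 then 1 else 0)) =
        (1 : Matrix (Fin 2 × Fin 2) (Fin 2 × Fin 2) k) p q := by
    intro p q
    rw [Matrix.one_apply]
    simp only [Prod.ext_iff]
    split_ifs <;> simp_all
  have h1 : M * M'' = 1 := by
    ext p q
    rw [Matrix.mul_apply, Fintype.sum_prod_type, ← hone]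
    exact hs p.1 q.1 p.2 q.2
  have h2 : M' * M = 1 := by
    ext p q
    rw [Matrix.mul_apply, Fintype.sum_prod_type, ← hone]
    have := Ring.inverse_mul_cancel _ hσ.isUnit
    rw [hσ.inverse_eq_twistRight antipode_antipode] at this
    have := congrArg (fun f => f.ofConv (x p.1 q.1 ⊗ₜ x p.2 q.2)) this
    simp only [isComatrix_x.conv_tmul_apply isComatrix_x,
      isComatrix_x.one_tmul_apply isComatrix_x] at this
    exact this
  have : M' = M'' := left_inv_eq_right_inv h2 h1
  exact congrFun (congrFun this (i, a)) (j, b)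

theorem drinfeld_x (hσ : IsBraiding σ) {s : Fin 2 → Fin 2 → Fin 2 → Fin 2 → k}
    (hs : ∀ i j a b, ∑ m, ∑ n, σ (x i m ⊗ₜ x a n) * s m j n b =
      (if i = j then 1 else 0) * (if a = b then 1 else 0)) (i j : Fin 2) :
    drinfeld σ (x i j) = ∑ m, s m j i m := by
  rw [drinfeld_apply σ isComatrix_x]
  simp only [inverse_apply hσ hs]

theorem drinfeld_antipode_x (hσ : IsBraiding σ) {s : Fin 2 → Fin 2 → Fin 2 → Fin 2 → k}
    (hs : ∀ i j a b, ∑ m, ∑ n, σ (x i m ⊗ₜ x a n) * s m j n b =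
      (if i = j then 1 else 0) * (if a = b then 1 else 0)) (i j : Fin 2) :
    (drinfeld σ ∘ₗ antipode k) (x i j) = ∑ m, s i m m j := by
  refine (drinfeld_apply σ isComatrix_x.antipode j i).trans ?_
  simp only [antipode_antipode, hσ.antipode_left antipode_antipode, inverse_apply hσ hs]

end Classification

end SuzukiAlg

/-! ### The braidings `σ_{αβ}` and `τ_{γδ}` -/

namespace SuzukiAlg

section Braidings

variable {k : Type*} [Field k] {N L : ℕ} {ν lam : ℤˣ}

/-- The values of `σ_{αβ}` at the generators. -/
def sigmaForm (α β : k) (i j l m : Fin 2) : k :=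
  if i ≠ j ∧ l = i ∧ m = j then α else if i ≠ j ∧ l = j ∧ m = i then β else 0

/-- The values of `τ_{γδ}` at the generators, where `δ` and `ε` are the values at
`(x₁₁, x₂₂)` and `(x₂₂, x₁₁)`. -/
def tauForm (γ δ ε : k) (i j l m : Fin 2) : k :=
  if i = j ∧ l = m then if i = l then γ else if i = 0 then δ else ε else 0

theorem sigmaForm_matrix (α β : k) :
    (fun i j => Matrix.of fun l m => sigmaForm α β i j l m) =
      ![![0, antidiag α β], ![antidiag β α, 0]] := by
  ext i j l m
  fin_cases i <;> fin_cases j <;> fin_cases l <;> fin_cases m <;> simp [sigmaForm]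

/-- The matrices of `σ_{αβ}(-, x_{lm})` are transposed, since multiplication in the second argument
reverses the order. -/
theorem sigmaForm_matrix' (α β : k) :
    (fun l m => Matrix.of fun i j => sigmaForm α β j i l m) =
      ![![0, antidiag β α], ![antidiag α β, 0]] := by
  ext i j l m
  fin_cases i <;> fin_cases j <;> fin_cases l <;> fin_cases m <;> simp [sigmaForm]

theorem tauForm_matrix (γ δ ε : k) :
    (fun i j => Matrix.of fun l m => tauForm γ δ ε i j l m) =
      ![![Matrix.diagonal ![γ, δ], 0], ![0, Matrix.diagonal ![ε, γ]]] := by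
  ext i j l m
  fin_cases i <;> fin_cases j <;> fin_cases l <;> fin_cases m <;> simp [tauForm]

/-- The matrices of `τ_{γδ}(-, x_{lm})`, transposed as in `sigmaForm_matrix'`. -/
theorem tauForm_matrix' (γ δ ε : k) :
    (fun l m => Matrix.of fun i j => tauForm γ δ ε j i l m) =
      ![![Matrix.diagonal ![γ, ε], 0], ![0, Matrix.diagonal ![δ, γ]]] := by
  ext i j l m
  fin_cases i <;> fin_cases j <;> fin_cases l <;> fin_cases m <;> simp [tauForm]

theorem sigmaForm_inverse {α β : k} (hα : α ≠ 0) (hβ : β ≠ 0) (i j a b : Fin 2) :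
    ∑ m, ∑ n, sigmaForm α β i m a n * sigmaForm α⁻¹ β⁻¹ m j n b =
      (if i = j then 1 else 0) * (if a = b then 1 else 0) := by
  fin_cases i <;> fin_cases j <;> fin_cases a <;> fin_cases b <;> simp [sigmaForm, hα, hβ]

theorem tauForm_inverse {γ δ ε : k} (hγ : γ ≠ 0) (hδ : δ ≠ 0) (hε : ε ≠ 0) (i j a b : Fin 2) :
    ∑ m, ∑ n, tauForm γ δ ε i m a n * tauForm γ⁻¹ δ⁻¹ ε⁻¹ m j n b =
      (if i = j then 1 else 0) * (if a = b then 1 else 0) := by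
  fin_cases i <;> fin_cases j <;> fin_cases a <;> fin_cases b <;> simp [tauForm, hγ, hδ, hε]

variable [NeZero N]

theorem existsUnique_sigma [NeZero L] {α β : k} (hN : (α * β) ^ N = ((ν : ℤ) : k))
    (hL : α ^ L = ((lam : ℤ) : k) * β ^ L) :
    ∃! σ : SuzukiAlg k N L ν lam ⊗[k] SuzukiAlg k N L ν lam →ₗ[k] k,
      IsBraiding σ ∧ ExtendsSigma α β σ := by
  refine existsUnique_braiding (sigmaForm α β) ?_ ?_ ?_
  · rw [sigmaForm_matrix]
    exact sat_off hN hL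
  · rw [sigmaForm_matrix']
    exact sat_off (by rw [mul_comm, hN])
      (by rw [hL, ← mul_assoc, intCast_unit_mul_self, one_mul])
  · have h := sat_x (k := k) (N := N) (L := L) (ν := ν) (lam := lam)
    have hd := h.sq 0 0
    have ho := h.sq 0 1
    simp only [pow_two, zero_add, Fin.reduceAdd] at hd ho
    have hz := h.mul_zero
    simp only [Fin.forall_fin_two] at hz
    simp at hz
    simp [Fin.forall_fin_two, Fin.sum_univ_two, sigmaForm, hd, ho, hz]

theorem existsUnique_tau {γ δ : k} (hγδ : γ ^ 2 = δ ^ 2) (hγ : γ ^ (2 * N) = 1) :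
    ∃! τ : SuzukiAlg k N 2 ν lam ⊗[k] SuzukiAlg k N 2 ν lam →ₗ[k] k,
      IsBraiding τ ∧ ExtendsTau γ δ τ := by
  have hl : (((lam : ℤ) : k) * δ) ^ 2 = γ ^ 2 := by
    rw [mul_pow, pow_two ((lam : ℤ) : k), intCast_unit_mul_self, one_mul, hγδ]
  have hδ : δ ^ (2 * N) = 1 := by rw [pow_mul, ← hγδ, ← pow_mul, hγ]
  have hε : (((lam : ℤ) : k) * δ) ^ (2 * N) = 1 := by rw [pow_mul, hl, ← pow_mul, hγ]
  refine existsUnique_braiding (tauForm γ δ (((lam : ℤ) : k) * δ)) ?_ ?_ ?_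
  · rw [tauForm_matrix]
    exact sat_diag_two hl.symm hγδ.symm hγ hδ
  · rw [tauForm_matrix']
    exact sat_diag_two hγδ hl hγ hε
  · have h := sat_x (k := k) (N := N) (L := 2) (ν := ν) (lam := lam)
    have hd := h.chi_diag
    have ho := h.chi_off
    simp only [chi, mul_one, zero_add, Fin.reduceAdd, intCast_unit_mul k] at hd ho
    have hz := h.mul_zero
    simp only [Fin.forall_fin_two] at hz
    simp at hz
    have hu := intCast_unit_mul_self (R := k) lam
    have hu' : ((lam : ℤ) : k) * (δ * ((lam : ℤ) : k)) = δ := by linear_combination δ * hu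
    simp [Fin.forall_fin_two, Fin.sum_univ_two, tauForm, hd, ho, hz, smul_smul, hu', mul_comm]

/-- For `σ_{αβ}`, both `u` and `u ∘ S` act on the generators by the scalar `β⁻¹`. -/
theorem drinfeld_sigma [NeZero L] {α β : k} (hα : α ≠ 0) (hβ : β ≠ 0)
    {σ : SuzukiAlg k N L ν lam ⊗[k] SuzukiAlg k N L ν lam →ₗ[k] k} (hσ : IsBraiding σ)
    (h : ExtendsSigma α β σ) :
    ExtendsTheta β⁻¹ (drinfeld σ) ∧ ExtendsTheta β⁻¹ (drinfeld σ ∘ₗ HopfAlgebra.antipode k) := by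
  have hs : ∀ i j a b, ∑ m, ∑ n, σ (x i m ⊗ₜ x a n) * sigmaForm α⁻¹ β⁻¹ m j n b =
      (if i = j then 1 else 0) * (if a = b then 1 else 0) := fun i j a b => by
    simp only [h _ _ _ _]
    exact sigmaForm_inverse hα hβ i j a b
  refine ⟨fun i j => ?_, fun i j => ?_⟩
  · rw [drinfeld_x hσ hs]
    fin_cases i <;> fin_cases j <;> simp [sigmaForm]
  · rw [drinfeld_antipode_x hσ hs]
    fin_cases i <;> fin_cases j <;> simp [sigmaForm]

/-- For `τ_{γδ}`, both `u` and `u ∘ S` act on the generators by the scalar `γ⁻¹`. -/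
theorem drinfeld_tau {γ δ : k} (hγ : γ ≠ 0) (hδ : δ ≠ 0)
    {τ : SuzukiAlg k N 2 ν lam ⊗[k] SuzukiAlg k N 2 ν lam →ₗ[k] k} (hτ : IsBraiding τ)
    (h : ExtendsTau γ δ τ) :
    ExtendsTheta γ⁻¹ (drinfeld τ) ∧ ExtendsTheta γ⁻¹ (drinfeld τ ∘ₗ HopfAlgebra.antipode k) := by
  have hl : ((lam : ℤ) : k) * δ ≠ 0 :=
    mul_ne_zero (left_ne_zero_of_mul_eq_one (intCast_unit_mul_self lam)) hδ
  have hs : ∀ i j a b, ∑ m, ∑ n, τ (x i m ⊗ₜ x a n) *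
      tauForm γ⁻¹ δ⁻¹ (((lam : ℤ) : k) * δ)⁻¹ m j n b =
      (if i = j then 1 else 0) * (if a = b then 1 else 0) := fun i j a b => by
    simp only [h _ _ _ _]
    exact tauForm_inverse hγ hδ hl i j a b
  refine ⟨fun i j => ?_, fun i j => ?_⟩
  · rw [drinfeld_x hτ hs]
    fin_cases i <;> fin_cases j <;> simp [tauForm]
  · rw [drinfeld_antipode_x hτ hs]
    fin_cases i <;> fin_cases j <;> simp [tauForm]

end Braidings

end SuzukiAlg

theorem mainTheorem2 {k : Type*} [Field k] [IsAlgClosed k] (N : ℕ) [NeZero N] (ν lam : ℤˣ) :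
    (∀ (L : ℕ) [NeZero L], 2 ≤ L → ¬ ringChar k ∣ 2 * N * L →
      ∀ α β : k, α ≠ 0 → β ≠ 0 → (α * β) ^ N = ((ν : ℤ) : k) → (α * β⁻¹) ^ L = ((lam : ℤ) : k) →
      (∃! σ : SuzukiAlg k N L ν lam ⊗[k] SuzukiAlg k N L ν lam →ₗ[k] k, IsBraiding σ ∧ ExtendsSigma α β σ) ∧
      ∀ σ : SuzukiAlg k N L ν lam ⊗[k] SuzukiAlg k N L ν lam →ₗ[k] k, IsBraiding σ → ExtendsSigma α β σ →
        (∀ ω : k, (∃ θ, IsCoribbon σ θ ∧ ExtendsTheta ω θ) ↔ ω ^ (2 * N) = α ^ (2 * N)) ∧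
        (∀ θ, IsCoribbon σ θ →
          ∃ ω : k, ExtendsTheta ω θ ∧ ∀ θ', IsCoribbon σ θ' → ExtendsTheta ω θ' → θ' = θ) ∧
        (∀ ω : k, (∃ θ, IsHopfCoribbon σ θ ∧ ExtendsTheta ω θ) ↔ ω = β⁻¹ ∨ ω = -β⁻¹) ∧
        {θ | IsHopfCoribbon σ θ}.ncard = 2) ∧
    (¬ ringChar k ∣ 2 * N * 2 →
      ∀ γ δ : k, γ ≠ 0 → δ ≠ 0 → γ ^ 2 = δ ^ 2 → γ ^ (2 * N) = 1 →
      (∃! τ : SuzukiAlg k N 2 ν lam ⊗[k] SuzukiAlg k N 2 ν lam →ₗ[k] k, IsBraiding τ ∧ ExtendsTau γ δ τ) ∧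
      ∀ τ : SuzukiAlg k N 2 ν lam ⊗[k] SuzukiAlg k N 2 ν lam →ₗ[k] k, IsBraiding τ → ExtendsTau γ δ τ →
        (∀ ω : k, (∃ θ, IsCoribbon τ θ ∧ ExtendsTheta ω θ) ↔ ω ^ (2 * N) = 1) ∧
        (∀ θ, IsCoribbon τ θ →
          ∃ ω : k, ExtendsTheta ω θ ∧ ∀ θ', IsCoribbon τ θ' → ExtendsTheta ω θ' → θ' = θ) ∧
        (∀ ω : k, (∃ θ, IsHopfCoribbon τ θ ∧ ExtendsTheta ω θ) ↔ ω = γ⁻¹ ∨ ω = -γ⁻¹) ∧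
        {θ | IsHopfCoribbon τ θ}.ncard = 2) := by
  have hcast : ∀ {n m l : ℕ}, ¬ ringChar k ∣ n * m * l → (l : k) ≠ 0 := fun h h0 =>
    h ((ringChar.spec k _).mp h0 |>.mul_left _)
  have htwo : ∀ {n m : ℕ}, ¬ ringChar k ∣ 2 * n * m → (2 : k) ≠ 0 := fun h h0 =>
    h (((ringChar.spec k 2).mp (by exact_mod_cast h0)).mul_right _ |>.mul_right _)
  refine ⟨fun L _ hL hchar α β hα hβ hN hlam => ⟨?_, fun σ hσ hs => ?_⟩,
    fun hchar γ δ hγ hδ hγδ hN => ⟨SuzukiAlg.existsUnique_tau hγδ hN, fun τ hτ ht => ?_⟩⟩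
  · refine SuzukiAlg.existsUnique_sigma hN ?_
    rw [← hlam, mul_pow, inv_pow, inv_mul_cancel_right₀ (pow_ne_zero _ hβ)]
  · obtain ⟨hu, hu'⟩ := SuzukiAlg.drinfeld_sigma hα hβ hσ hs
    -- `(αβ)^N = ν = ±1`.
    have hαβ : β⁻¹ ^ (2 * N) = α ^ (2 * N) := by
      have : (α * β) ^ (2 * N) = 1 := by
        rw [mul_comm 2, pow_mul, hN, pow_two, SuzukiAlg.intCast_unit_mul_self]
      rw [inv_pow, inv_eq_of_mul_eq_one_left (by rw [← mul_pow, this])]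
    simpa only [hαβ] using SuzukiAlg.coribbon_classification hL (hcast hchar) (htwo hchar) hσ hu hu'
  · obtain ⟨hu, hu'⟩ := SuzukiAlg.drinfeld_tau hγ hδ hτ ht
    have hγ' : γ⁻¹ ^ (2 * N) = 1 := by rw [inv_pow, hN, inv_one]
    simpa only [hγ'] using
      SuzukiAlg.coribbon_classification le_rfl (hcast hchar) (htwo hchar) hτ hu hu'
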